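/- Let $n\ge 1$, let $e_1,\dots,e_n$ be the standard basis of $\mathbb R^n$, and let $\Phi_{B_n}=\{\pm e_i\pm e_j: i\ne j\}\cup\{\pm e_i\}$, $\Phi_{C_n}=\{\pm e_i\pm e_j: i\neq j\}\cup\{\pm 2e_i\}$, with positive roots $\Phi_{B_n}^+=\{e_i+e_j: i\ne j\}\cup\{e_i-e_j: i<j\}\cup\{e_i\}$ and $\Phi_{C_n}^+=\{e_i+e_j: i\ne j\}\cup\{e_i-e_j: i<j\}\cup\{2e_i\}$. For $\Phi\in\{\Phi_{B_n},\Phi_{C_n}\}$, a signed poset $P\subset\Phi$ is a subset such that $\alpha\in P$ implies $-\alpha\notin P$, and $P=\mathbb R_+P\cap\Phi$, where $\mathbb R_+P$ is the set of non-negative linear combinations of elements of $P$. Put $P^\vee=\{2\alpha/\langle\alpha,\alpha\rangle:\alpha\in P\}$; then $P\subset\Phi_{B_n}$ is a signed poset if and only if $P^\vee\subset\Phi_{C_n}$ is one. A linear extension of $P\subset\Phi$ is a signed permutation $w$ of $\{\pm1,\dots,\pm n\}$ with $P\subset w\Phi^+$, where $w e_i=e_{w(i)}$ and $e_{-k}=-e_k$;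 the set of linear extensions is $\mathcal L(P)$. Signed permutations act on rational functions by $x_i\mapsto x_{w(i)}$, where $x_{-k}=-x_k$. Define the rational functions $$\Psi_P(\mathbf x)=\sum_{w\in\mathcal L(P)}w\left(\frac1{(x_1-x_2)\cdots(x_{n-1}-x_n)\,x_n}\right),\qquad \Phi_P(\mathbf x)=\sum_{w\in\mathcal L(P)}w\left(\frac1{x_1(x_1+x_2)\cdots(x_1+\cdots+x_n)}\right),$$ $$\Psi^\vee_{P^\vee}(\mathbf x)=\sum_{w\in\mathcal L(P^\vee)}w\left(\frac1{(x_1-x_2)\cdots(x_{n-1}-x_n)\,2x_n}\right),$$ $$\Phi^\vee_{P^\vee}(\mathbf x)=\sum_{w\in\mathcal L(P^\vee)}w\left(\frac1{x_1(x_1+x_2)\cdots(x_1+\cdots+x_{n-1})\left(\tfrac12x_1+\cdots+\tfrac12x_n\right)}\right).$$ Let $K_P^{\mathrm{rt}}=\mathbb R_+P$ and $K_P^{\mathrm{wt}}=\{f\in\mathbb R^n:\langle f,\alpha\rangle\ge0\ \forall\alpha\in P\}$ be the root cone and the weight cone. For a polyhedral cone $K\subset\mathbb R^n$ with dual cone $K^*$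 and a positive multiple $\mu$ of Lebesgue measure $du$, let $s_\mu(K;\mathbf x)$ be the rational function whose value at each $\mathbf x\in\operatorname{Int}K^*$ is $\int_Ke^{-\langle\mathbf x,u\rangle}\,d\mu(u)$ if $K$ is full-dimensional and pointed (contains no line), and $s_\mu(K;\mathbf x)=0$ otherwise. Theorem. Suppose $P\subset\Phi_{B_n}$ (resp. $P^\vee\subset\Phi_{C_n}$) is a signed poset. Then, as rational functions, $$\Psi_P(\mathbf x)=s_{du}(K_P^{\mathrm{rt}};\mathbf x),\qquad \Phi_P(\mathbf x)=s_{du}(K_P^{\mathrm{wt}};\mathbf x),$$ $$\text{(resp. }\ \Psi^\vee_{P^\vee}(\mathbf x)=s_{\frac12du}(K_P^{\mathrm{rt}};\mathbf x),\qquad \Phi^\vee_{P^\vee}(\mathbf x)=s_{2du}(K_P^{\mathrm{wt}};\mathbf x)\text{)}.$$ Moreover, in each case, with $K$ the cone and $\mu$ the measure on the right-hand side, for every $\mathbf x\in\operatorname{Int}K^*$ the integral $\int_Ke^{-\langle\mathbf x,u\rangle}\,d\mu(u)$ converges, the rational function on the left is regular at $\mathbf x$, and its value there is this integral. -/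

import Mathlib

open MeasureTheory

noncomputable section

namespace SignedPoset

/-- Euclidean space `ℝⁿ`; coordinates are indexed by `Fin n`, so `x₁, …, xₙ` are `x 0, …, x (n-1)`. -/
abbrev E (n : ℕ) : Type := EuclideanSpace ℝ (Fin n)

/-- The standard basis vector `eᵢ`. -/
def e {n : ℕ} (i : Fin n) : E n := EuclideanSpace.single i (1 : ℝ)

/-! ### The root systems of types B and C -/

/-- The roots of type `Bₙ`: `±eᵢ ± eⱼ` with `i ≠ j` (independent signs), and `±eᵢ`. -/
def rootsB (n : ℕ) : Set (E n) :=
  {v | ∃ i j : Fin n, i ≠ j ∧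
      (v = e i + e j ∨ v = e i - e j ∨ v = -e i + e j ∨ v = -e i - e j)} ∪
    {v | ∃ i : Fin n, v = e i ∨ v = -e i}

/-- The roots of type `Cₙ`: `±eᵢ ± eⱼ` with `i ≠ j` (independent signs), and `±2eᵢ`. -/
def rootsC (n : ℕ) : Set (E n) :=
  {v | ∃ i j : Fin n, i ≠ j ∧
      (v = e i + e j ∨ v = e i - e j ∨ v = -e i + e j ∨ v = -e i - e j)} ∪
    {v | ∃ i : Fin n, v = (2 : ℝ) • e i ∨ v = -((2 : ℝ) • e i)}

/-- The positive roots of type `Bₙ` for the simple roots `e₁ - e₂, …, eₙ₋₁ - eₙ, eₙ`. -/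
def posRootsB (n : ℕ) : Set (E n) :=
  {v | ∃ i j : Fin n, i ≠ j ∧ v = e i + e j} ∪ {v | ∃ i j : Fin n, i < j ∧ v = e i - e j} ∪
    {v | ∃ i : Fin n, v = e i}

/-- The positive roots of type `Cₙ` for the simple roots `e₁ - e₂, …, eₙ₋₁ - eₙ, 2eₙ`. -/
def posRootsC (n : ℕ) : Set (E n) :=
  {v | ∃ i j : Fin n, i ≠ j ∧ v = e i + e j} ∪ {v | ∃ i j : Fin n, i < j ∧ v = e i - e j} ∪
    {v | ∃ i : Fin n, v = (2 : ℝ) • e i}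

/-- The coroot `α^∨ = 2α / ⟨α, α⟩`. -/
def coroot {n : ℕ} (α : E n) : E n := (2 / inner ℝ α α : ℝ) • α

/-- The dual `P^∨ = {α^∨ : α ∈ P}`. -/
def dual {n : ℕ} (P : Set (E n)) : Set (E n) := coroot '' P

/-! ### Signed posets and their cones -/

/-- The positive span `ℝ₊ S`: all finite linear combinations of elements of `S` with
non-negative real coefficients. -/
def posSpan {n : ℕ} (S : Set (E n)) : Set (E n) := (Submodule.span NNReal S : Set (E n))

/-- A `Φ`-poset: a subset `P` of `Φ` which contains no two opposite roots and which is its own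
positive linear closure `ℝ₊ P ∩ Φ`. -/
structure IsPhiPoset {n : ℕ} (Φ P : Set (E n)) : Prop where
  subset : P ⊆ Φ
  neg_notMem : ∀ α ∈ P, -α ∉ P
  closed : P = posSpan P ∩ Φ

/-- The root cone `ℝ₊ P`. -/
def rootCone {n : ℕ} (P : Set (E n)) : Set (E n) := posSpan P

/-- The weight cone `{f : ⟨f, α⟩ ≥ 0 for all α ∈ P}`. -/
def weightCone {n : ℕ} (P : Set (E n)) : Set (E n) := {f | ∀ α ∈ P, 0 ≤ (inner ℝ f α : ℝ)}

/-! ### Signed permutations and linear extensions -/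

/-- The set `±[n] = {±1, …, ±n}`; the element `± i` is the pair `(±1, i)`. -/
abbrev PM (n : ℕ) : Type := ℤˣ × Fin n

/-- The involution `i ↦ -i` of `±[n]`. -/
def PM.opp {n : ℕ} (p : PM n) : PM n := (-p.1, p.2)

/-- The group of signed permutations (the Weyl group of types `Bₙ` and `Cₙ`): the permutations
`w` of `±[n]` such that `w (-i) = - w i`. -/
def SignedPerm (n : ℕ) : Subgroup (Equiv.Perm (PM n)) where
  carrier := {w | ∀ p, w p.opp = (w p).opp}
  one_mem' := fun _ => rfl
  mul_mem' := by
    intro a b ha hb p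
    simp only [Set.mem_ofPred_eq] at ha hb
    simp only [Equiv.Perm.mul_apply, hb, ha]
  inv_mem' := by
    intro a ha p
    simp only [Set.mem_ofPred_eq] at ha
    rw [Equiv.Perm.inv_eq_iff_eq, ha]
    exact congrArg PM.opp (a.apply_symm_apply p).symm

instance (n : ℕ) : Fintype (SignedPerm n) := Fintype.ofFinite _

/-- The vector `± eᵢ` attached to the element `± i` of `±[n]`. -/
def signedE {n : ℕ} (p : PM n) : E n := ((p.1 : ℤ) : ℝ) • e p.2

/-- The linear action of signed permutations on `ℝⁿ`, determined by `w eᵢ = e_{w i}`, where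
`e_{-k} = -eₖ`. -/
def act {n : ℕ} (w : SignedPerm n) (v : E n) : E n := ∑ i, v i • signedE (w.1 (1, i))

/-- The linear extensions of `P`, with respect to the positive roots `Φpos`: the `w` with
`P ⊆ w Φpos`. -/
def linearExtensions {n : ℕ} (Φpos P : Set (E n)) : Set (SignedPerm n) :=
  {w | P ⊆ act w '' Φpos}

/-! ### Rational functions and the action of signed permutations on them -/

/-- Polynomials in `x₁, …, xₙ`. -/
abbrev Pol (n : ℕ) : Type := MvPolynomial (Fin n) ℝ

/-- The field `ℝ(x₁, …, xₙ)`. -/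
abbrev RatFun (n : ℕ) : Type := FractionRing (Pol n)

/-- The polynomial `± xᵢ` attached to the element `± i` of `±[n]`. -/
def signedX {n : ℕ} (p : PM n) : Pol n := ((p.1 : ℤ) : Pol n) * MvPolynomial.X p.2

/-- The substitution `xᵢ ↦ x_{w i}` on polynomials, where `x_{-k} = -xₖ`. -/
def polHom {n : ℕ} (w : SignedPerm n) : Pol n →ₐ[ℝ] Pol n :=
  MvPolynomial.aeval fun i => signedX (w.1 (1, i))

theorem polHom_signedX {n : ℕ} (w : SignedPerm n) (p : PM n) :
    polHom w (signedX p) = signedX (w.1 p) := by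
  obtain ⟨s, i⟩ := p
  rcases Int.units_eq_one_or s with rfl | rfl
  · simp [signedX, polHom]
  · have h : w.1 (-1, i) = (w.1 (1, i)).opp := w.2 (1, i)
    rw [h]
    simp [signedX, polHom, PM.opp]

theorem polHom_comp_inv {n : ℕ} (w v : SignedPerm n) (h : w * v = 1) :
    (polHom w).comp (polHom v) = AlgHom.id ℝ (Pol n) := by
  refine MvPolynomial.algHom_ext fun i => ?_
  have h1 : polHom v (MvPolynomial.X i) = signedX (v.1 (1, i)) := by simp [polHom]
  have h2 : w.1 (v.1 (1, i)) = (1, i) := by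
    rw [← Equiv.Perm.mul_apply, ← Subgroup.coe_mul, h]
    rfl
  rw [AlgHom.comp_apply, h1, polHom_signedX, h2]
  simp [signedX]

/-- The substitution `xᵢ ↦ x_{w i}` as an automorphism of the polynomial ring. -/
def polAct {n : ℕ} (w : SignedPerm n) : Pol n ≃ₐ[ℝ] Pol n :=
  AlgEquiv.ofAlgHom (polHom w) (polHom w⁻¹) (polHom_comp_inv _ _ (mul_inv_cancel w))
    (polHom_comp_inv _ _ (inv_mul_cancel w))

/-- The action of signed permutations on rational functions: `w` substitutes `x_{w i}` for `xᵢ`,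
where `x_{-k} = -xₖ`. -/
def ratAct {n : ℕ} (w : SignedPerm n) : RatFun n ≃+* RatFun n :=
  IsFractionRing.ringEquivOfRingEquiv (polAct w).toRingEquiv

/-- `∑_{w ∈ L} w (1 / D)`. -/
def sumOver {n : ℕ} (L : Set (SignedPerm n)) (D : Pol n) : RatFun n :=
  open Classical in
  ∑ w ∈ Finset.univ.filter (fun w => w ∈ L), ratAct w (1 / algebraMap (Pol n) (RatFun n) D)

/-- `(x₁ - x₂)(x₂ - x₃) ⋯ (xₙ₋₁ - xₙ) xₙ`. -/
def psiDenB (n : ℕ) : Pol n :=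
  ∏ i : Fin n, if h : i.1 + 1 < n then MvPolynomial.X i - MvPolynomial.X ⟨i.1 + 1, h⟩
    else MvPolynomial.X i

/-- `(x₁ - x₂)(x₂ - x₃) ⋯ (xₙ₋₁ - xₙ) 2xₙ`. -/
def psiDenC (n : ℕ) : Pol n :=
  ∏ i : Fin n, if h : i.1 + 1 < n then MvPolynomial.X i - MvPolynomial.X ⟨i.1 + 1, h⟩
    else 2 * MvPolynomial.X i

/-- `x₁ (x₁ + x₂) ⋯ (x₁ + ⋯ + xₙ)`. -/
def phiDenB (n : ℕ) : Pol n :=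
  ∏ i : Fin n, ∑ j ∈ Finset.Iic i, MvPolynomial.X j

/-- `x₁ (x₁ + x₂) ⋯ (x₁ + ⋯ + xₙ₋₁) (½x₁ + ⋯ + ½xₙ)`. -/
def phiDenC (n : ℕ) : Pol n :=
  ∏ i : Fin n, if i.1 + 1 < n then ∑ j ∈ Finset.Iic i, MvPolynomial.X j
    else ∑ j ∈ Finset.Iic i, MvPolynomial.C (1 / 2 : ℝ) * MvPolynomial.X j

/-- `Ψ_P`, for `P ⊆ Φ_B`. -/
def PsiB {n : ℕ} (P : Set (E n)) : RatFun n :=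
  sumOver (linearExtensions (posRootsB n) P) (psiDenB n)

/-- `Φ_P`, for `P ⊆ Φ_B`. -/
def PhiB {n : ℕ} (P : Set (E n)) : RatFun n :=
  sumOver (linearExtensions (posRootsB n) P) (phiDenB n)

/-- `Ψ^∨_Q`, for `Q ⊆ Φ_C`. -/
def PsiC {n : ℕ} (Q : Set (E n)) : RatFun n :=
  sumOver (linearExtensions (posRootsC n) Q) (psiDenC n)

/-- `Φ^∨_Q`, for `Q ⊆ Φ_C`. -/
def PhiC {n : ℕ} (Q : Set (E n)) : RatFun n :=
  sumOver (linearExtensions (posRootsC n) Q) (phiDenC n)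

/-! ### Exponential integrals over cones -/

/-- The rational function `r` is regular at `x` and takes the value `c` there. -/
def HasValueAt {n : ℕ} (r : RatFun n) (x : E n) (c : ℝ) : Prop :=
  ∃ p q : Pol n, MvPolynomial.eval (fun i => x i) q ≠ 0 ∧
    r = algebraMap (Pol n) (RatFun n) p / algebraMap (Pol n) (RatFun n) q ∧
    c = MvPolynomial.eval (fun i => x i) p / MvPolynomial.eval (fun i => x i) q

/-- The dual cone `K*`. -/
def dualCone {n : ℕ} (K : Set (E n)) : Set (E n) := {x | ∀ u ∈ K, 0 ≤ (inner ℝ x u : ℝ)}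

/-- A cone is pointed if it contains no line. -/
def IsPointed {n : ℕ} (K : Set (E n)) : Prop :=
  ¬ ∃ u v : E n, v ≠ 0 ∧ ∀ t : ℝ, u + t • v ∈ K

/-- A cone in `ℝⁿ` is full-dimensional if it spans `ℝⁿ`. -/
def IsFullDim {n : ℕ} (K : Set (E n)) : Prop := Submodule.span ℝ K = ⊤

/-- For every `x` in the interior of `K*`, the integral `∫_K e^{-⟨x, u⟩} dμ(u)` converges, the
rational function `r` is regular at `x`, and its value there is that integral. -/
def IsExpIntegral {n : ℕ} (μ : Measure (E n)) (K : Set (E n)) (r : RatFun n) : Prop :=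
  ∀ x ∈ interior (dualCone K),
    IntegrableOn (fun u => Real.exp (-(inner ℝ x u : ℝ))) K μ ∧
      HasValueAt r x (∫ u in K, Real.exp (-(inner ℝ x u : ℝ)) ∂μ)

/-- The valuation `s(K; x)` of a polyhedral cone `K`, with respect to the measure `μ`: the
rational function that is given by `∫_K e^{-⟨x, u⟩} dμ(u)` for `x` in the interior of `K*` if `K`
is pointed and full-dimensional, and `0` if `K` is not pointed or not full-dimensional. -/
def s {n : ℕ} (μ : Measure (E n)) (K : Set (E n)) : RatFun n :=
  open Classical in
  if h : IsPointed K ∧ IsFullDim K ∧ ∃ r : RatFun n, IsExpIntegral μ K r then h.2.2.choose else 0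

end SignedPoset

end

noncomputable section

namespace SignedPoset

open Filter Topology

variable {n : ℕ}

/-! ### Polynomials on Euclidean space and functions that are analytic along lines -/

/-! A signed permutation `w` contributes to `Ψ` or `Φ` the reciprocal of a product of linear forms.
This is the exponential integral of the simplicial cone spanned by the images under `w` of the
simple roots, respectively of their dual basis. Both bases have determinant 1, so no constant
appears. It remains to add these cones up, as rational functions, to the root cone or the weight
cone.

Weight cones: away from the root hyperplanes, which are null, each point lies in exactly one
chamber, and the chambers making up the weight cone of `S` are those of the linear extensions of
`S`. So the integral is literally a sum (`expInt_weightCone`).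

Root cones: induction on the number of linear extensions (`repOn_PsiB`). Either the root cone is
already the simplicial cone of the only linear extension, or some root `α` splits the linear
extensions of `S` into the non-empty families for `S ∪ {α}` and `S ∪ {-α}`. The cones `K + ℝ₊α` and
`K - ℝ₊α` meet in `K` and have union `K + ℝα`, which contains a line, so inclusion-exclusion
suggests that the rational functions of the two cones add up to that of `K`
(`repOn_posSpan_of_split`).

The principle that a set invariant under a translation has valuation zero is `RepOn.continuation`.
It makes sense of integrals with different domains of convergence by comparing both pieces with a
slab on which both converge and continuing analytically. The same principle gives `Φ = 0` when the
weight cone contains a line (`PhiB_eq_zero`), where the dual cone has empty interior and the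
integral says nothing.

All of this is done for arbitrary sets of roots `S`; the poset axioms serve only to produce a vector
positive on `P`. Regularity on the whole open dual cone holds because the integral is analytic
there, so denominator factors vanishing at a point cancel (`exists_regular_fraction`). Type C has
the same linear extensions as type B, and its denominators differ by a constant. -/

/-- The value of a polynomial at a point. -/
def ev (x : E n) : Pol n →+* ℝ := MvPolynomial.eval fun i => x i

/-- A function is line-analytic on `U` if its restriction to any line is analytic at each point
of `U`. -/
def LineAnalytic (g : E n → ℝ) (U : Set (E n)) : Prop :=
  ∀ x ∈ U, ∀ v : E n, AnalyticAt ℝ (fun t : ℝ => g (x + t • v)) 0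

theorem LineAnalytic.mono {g : E n → ℝ} {U V : Set (E n)} (h : LineAnalytic g U) (hV : V ⊆ U) :
    LineAnalytic g V := fun x hx => h x (hV hx)

theorem LineAnalytic.mul {f g : E n → ℝ} {U : Set (E n)} (hf : LineAnalytic f U)
    (hg : LineAnalytic g U) : LineAnalytic (fun x => f x * g x) U :=
  fun x hx v => (hf x hx v).mul (hg x hx v)

theorem LineAnalytic.sub {f g : E n → ℝ} {U : Set (E n)} (hf : LineAnalytic f U)
    (hg : LineAnalytic g U) : LineAnalytic (fun x => f x - g x) U :=
  fun x hx v => (hf x hx v).sub (hg x hx v)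

theorem lineAnalytic_ev (p : Pol n) (U : Set (E n)) : LineAnalytic (fun x => ev x p) U := by
  intro x _ v
  induction p using MvPolynomial.induction_on with
  | C a => simpa [ev] using analyticAt_const
  | add p q hp hq => simpa [ev] using hp.fun_add hq
  | mul_X p i hp =>
    have h : AnalyticAt ℝ (fun t : ℝ => (x + t • v) i) 0 := by
      simp only [PiLp.add_apply, PiLp.smul_apply, smul_eq_mul]
      exact analyticAt_const.add (analyticAt_id.mul analyticAt_const)
    simpa [ev] using hp.fun_mul h

theorem LineAnalytic.at {g : E n → ℝ} {U : Set (E n)} (hg : LineAnalytic g U) {x v : E n} {t : ℝ}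
    (h : x + t • v ∈ U) : AnalyticAt ℝ (fun s : ℝ => g (x + s • v)) t := by
  have h1 := hg _ h v
  have h2 : AnalyticAt ℝ (fun s : ℝ => s - t) t := analyticAt_id.sub analyticAt_const
  have h3 : AnalyticAt ℝ (fun s : ℝ => g (x + t • v + s • v)) (t - t) := by simpa using h1
  have h4 := AnalyticAt.fun_comp (f := fun s : ℝ => s - t) h3 h2
  refine h4.congr (Eventually.of_forall fun s => ?_)
  simp only
  congr 1
  module

theorem tendsto_line (x v : E n) : Tendsto (fun t : ℝ => x + t • v) (𝓝 0) (𝓝 x) := by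
  have : Continuous fun t : ℝ => x + t • v := by fun_prop
  simpa using this.tendsto 0

/-- The identity theorem along segments. -/
theorem LineAnalytic.eq_zero {g : E n → ℝ} {U W : Set (E n)} (hg : LineAnalytic g U)
    (hU : Convex ℝ U) (hW : IsOpen W) (hne : (W ∩ U).Nonempty) (h0 : ∀ x ∈ W, g x = 0) :
    ∀ x ∈ U, g x = 0 := by
  obtain ⟨x₀, hx₀W, hx₀U⟩ := hne
  intro x hx
  have han : AnalyticOnNhd ℝ (fun t : ℝ => g (x₀ + t • (x - x₀))) (Set.Icc 0 1) := fun t ht =>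
    hg.at (hU.add_smul_sub_mem hx₀U hx ht)
  have hev : (fun t : ℝ => g (x₀ + t • (x - x₀))) =ᶠ[𝓝 0] 0 :=
    ((tendsto_line x₀ (x - x₀)).eventually (hW.mem_nhds hx₀W)).mono fun t ht => h0 _ ht
  have := han.eqOn_zero_of_preconnected_of_eventuallyEq_zero isPreconnected_Icc
    (Set.left_mem_Icc.2 zero_le_one) hev (Set.right_mem_Icc.2 zero_le_one)
  simpa using this

theorem eq_zero_of_ev_eq_zero {p : Pol n} {W : Set (E n)} (hW : IsOpen W) (hne : W.Nonempty)
    (h0 : ∀ x ∈ W, ev x p = 0) : p = 0 := by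
  refine MvPolynomial.funext fun x => ?_
  have := (lineAnalytic_ev p Set.univ).eq_zero convex_univ hW (by simpa using hne) h0
    (WithLp.toLp 2 x) (Set.mem_univ _)
  simpa [ev] using this

/-- On a line from `x` to a point where `q ≠ 0`, the zeros of `q` are isolated. So `g` vanishes at
the nearby points of this line other than `x`, and at `x` by continuity. -/
theorem LineAnalytic.eq_zero_of_mul {g : E n → ℝ} {U : Set (E n)} (hg : LineAnalytic g U)
    (hU : IsOpen U) {q : Pol n} (hq : q ≠ 0) (h0 : ∀ x ∈ U, ev x q * g x = 0) :
    ∀ x ∈ U, g x = 0 := by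
  intro x hx
  obtain ⟨y, hy⟩ : ∃ y : E n, ev y q ≠ 0 := by
    by_contra! h
    exact hq (eq_zero_of_ev_eq_zero isOpen_univ Set.univ_nonempty fun x _ => h x)
  have han : AnalyticOnNhd ℝ (fun t : ℝ => ev (x + t • (y - x)) q) Set.univ := fun t _ =>
    (lineAnalytic_ev q Set.univ).at (Set.mem_univ _)
  rcases (han 0 (Set.mem_univ _)).eventually_eq_zero_or_eventually_ne_zero with h | h
  · have := han.eqOn_zero_of_preconnected_of_eventuallyEq_zero isPreconnected_univ
      (Set.mem_univ 0) h (Set.mem_univ 1)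
    simp [hy] at this
  · have h1 : ∀ᶠ t : ℝ in 𝓝[≠] 0, g (x + t • (y - x)) = 0 := by
      filter_upwards [h, ((tendsto_line x (y - x)).mono_left nhdsWithin_le_nhds).eventually
        (hU.mem_nhds hx)] with t ht htU
      exact (mul_eq_zero.1 (h0 _ htU)).resolve_left ht
    have h2 := (hg x hx (y - x)).continuousAt.tendsto.mono_left
      (nhdsWithin_le_nhds (s := {(0 : ℝ)}ᶜ))
    have h3 := tendsto_nhds_unique (h2.congr' h1) tendsto_const_nhds
    simpa using h3

/-! ### Linear forms -/

/-- The linear form `⟨x, v⟩` as a polynomial in `x`. -/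
def lin (v : E n) : Pol n := ∑ i, MvPolynomial.C (v i) * MvPolynomial.X i

@[simp] theorem ev_lin (x v : E n) : ev x (lin v) = inner ℝ x v := by
  simp [ev, lin, PiLp.inner_apply]

theorem lin_ne_zero {v : E n} (hv : v ≠ 0) : lin v ≠ 0 := by
  intro h
  have := ev_lin v v
  rw [h, map_zero] at this
  exact hv (inner_self_eq_zero.1 this.symm)

/-- The products of non-zero linear forms. -/
def linProds (n : ℕ) : Submonoid (Pol n) := Submonoid.closure {l | ∃ v : E n, v ≠ 0 ∧ l = lin v}

theorem lin_mem_linProds {v : E n} (hv : v ≠ 0) : lin v ∈ linProds n :=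
  Submonoid.subset_closure ⟨v, hv, rfl⟩

theorem ne_zero_of_mem_linProds {q : Pol n} (hq : q ∈ linProds n) : q ≠ 0 := by
  induction hq using Submonoid.closure_induction with
  | mem q h => obtain ⟨v, hv, rfl⟩ := h; exact lin_ne_zero hv
  | one => exact one_ne_zero
  | mul a b _ _ ha hb => exact mul_ne_zero ha hb

/-- A polynomial that vanishes on the hyperplane `v^⊥` near one of its points is divisible by the
linear form of `v`. -/
theorem lin_dvd {p : Pol n} {v x : E n} (hv : v ≠ 0) {W : Set (E n)} (hW : IsOpen W)
    (hx : x ∈ W) (hxv : inner ℝ x v = 0) (h0 : ∀ y ∈ W, inner ℝ y v = 0 → ev y p = 0) :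
    lin v ∣ p := by
  set c : ℝ := (inner ℝ v v)⁻¹ with hc
  have hvv : (inner ℝ v v : ℝ) ≠ 0 := fun h => hv (inner_self_eq_zero.1 h)
  -- Substitution of the orthogonal projection `π` onto `v^⊥`. It kills `p` by hypothesis, yet it is
  -- the identity modulo `lin v`, so `p` is zero modulo `lin v`.
  let φ : Pol n →ₐ[ℝ] Pol n :=
    MvPolynomial.aeval fun j => MvPolynomial.X j - MvPolynomial.C (c * v j) * lin v
  let π : E n → E n := fun y => y - (c * inner ℝ y v) • v
  have hev : ∀ y q, ev y (φ q) = ev (π y) q := by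
    intro y q
    induction q using MvPolynomial.induction_on with
    | C a => simp [ev, φ]
    | add p q hp hq => simp [hp, hq]
    | mul_X q i hq =>
      rw [map_mul, map_mul, hq, map_mul]
      congr 1
      have h1 : φ (MvPolynomial.X i) = MvPolynomial.X i - MvPolynomial.C (c * v i) * lin v := by
        simp [φ]
      rw [h1, map_sub, map_mul, ev_lin]
      simp only [ev, MvPolynomial.eval_X, MvPolynomial.eval_C, π, PiLp.sub_apply,
        PiLp.smul_apply, smul_eq_mul]
      ring
  have hπ : Continuous π := by fun_prop
  have hφ : φ p = 0 := by
    refine eq_zero_of_ev_eq_zero (hW.preimage hπ) ⟨x, ?_⟩ fun y hy => ?_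
    · simpa [π, hxv] using hx
    · rw [hev]
      refine h0 _ hy ?_
      simp only [π, inner_sub_left, inner_smul_left, hc]
      simp
      field_simp
      simp
  have hcomp : (Ideal.Quotient.mkₐ ℝ (Ideal.span {lin v})).comp φ =
      Ideal.Quotient.mkₐ ℝ (Ideal.span {lin v}) := by
    refine MvPolynomial.algHom_ext fun i => ?_
    have : Ideal.Quotient.mk (Ideal.span {lin v}) (lin v) = 0 :=
      Ideal.Quotient.eq_zero_iff_mem.2 (Ideal.mem_span_singleton_self _)
    simp [φ, this]
  have h1 := congrArg (fun f => f p) hcomp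
  simp only [AlgHom.comp_apply, hφ, map_zero] at h1
  exact Ideal.mem_span_singleton.1 (Ideal.Quotient.eq_zero_iff_mem.1 h1.symm)

/-- The linear factors of `q` are removed one at a time. A factor vanishing at `x` divides `p`,
because `p = q g` vanishes on its hyperplane within `U`, and is cancelled; any other factor is
absorbed into `g` and returned to the new denominator. -/
theorem exists_regular_fraction {U : Set (E n)} (hU : IsOpen U) {x : E n} (hx : x ∈ U) {q : Pol n}
    (hq : q ∈ linProds n) : ∀ (p : Pol n) (g : E n → ℝ), LineAnalytic g U →
      (∀ y ∈ U, ev y p = ev y q * g y) →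
      ∃ p' q' : Pol n, ev x q' ≠ 0 ∧ p * q' = p' * q ∧ ev x p' = ev x q' * g x := by
  induction hq using Submonoid.closure_induction_left with
  | one => exact fun p g _ h => ⟨p, 1, by simp, by simp, by simpa using h x hx⟩
  | mul_left l hl q hq ih =>
    obtain ⟨v, hv, rfl⟩ := hl
    intro p g hg h
    by_cases hxv : (inner ℝ x v : ℝ) = 0
    · obtain ⟨p₀, rfl⟩ := lin_dvd hv hU hx hxv (p := p) fun y hy hyv => by
        rw [h y hy, map_mul, ev_lin, hyv]; ring
      have h1 : ∀ y ∈ U, ev y p₀ - ev y q * g y = 0 := by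
        refine ((lineAnalytic_ev p₀ U).sub ((lineAnalytic_ev q U).mul hg)).eq_zero_of_mul hU
          (lin_ne_zero hv) fun y hy => ?_
        have := h y hy
        rw [map_mul, map_mul] at this
        linear_combination this
      obtain ⟨p', q', h2, h3, h4⟩ := ih p₀ g hg fun y hy => sub_eq_zero.1 (h1 y hy)
      exact ⟨p', q', h2, by linear_combination lin v * h3, h4⟩
    · obtain ⟨p', q', h2, h3, h4⟩ := ih p (fun y => ev y (lin v) * g y)
        ((lineAnalytic_ev (lin v) U).mul hg) fun y hy => by rw [h y hy, map_mul]; ring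
      refine ⟨p', lin v * q', ?_, by linear_combination lin v * h3, by rw [h4, map_mul]; ring⟩
      rw [map_mul, ev_lin]
      exact mul_ne_zero hxv h2

/-! ### Rational functions representing a function on a set -/

/-- The embedding of polynomials into rational functions. -/
abbrev toRat : Pol n →+* RatFun n := algebraMap (Pol n) (RatFun n)

theorem toRat_ne_zero {q : Pol n} (hq : q ≠ 0) : toRat q ≠ 0 :=
  (map_ne_zero_iff _ (IsFractionRing.injective (Pol n) (RatFun n))).2 hq

/-- `r` has a denominator that is a product of linear forms, and after clearing it `r` agrees
with `g` on `U`. -/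
def RepOn (U : Set (E n)) (r : RatFun n) (g : E n → ℝ) : Prop :=
  ∃ p q : Pol n, q ∈ linProds n ∧ r = toRat p / toRat q ∧ ∀ x ∈ U, ev x p = ev x q * g x

theorem RepOn.mono {U V : Set (E n)} {r : RatFun n} {g : E n → ℝ} (h : RepOn U r g)
    (hV : V ⊆ U) : RepOn V r g := by
  obtain ⟨p, q, hq, hr, hpq⟩ := h
  exact ⟨p, q, hq, hr, fun x hx => hpq x (hV hx)⟩

theorem RepOn.congr {U : Set (E n)} {r : RatFun n} {f g : E n → ℝ} (h : RepOn U r f)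
    (hfg : ∀ x ∈ U, f x = g x) : RepOn U r g := by
  obtain ⟨p, q, hq, hr, hpq⟩ := h
  exact ⟨p, q, hq, hr, fun x hx => by rw [hpq x hx, hfg x hx]⟩

theorem RepOn.add {U : Set (E n)} {r s : RatFun n} {f g : E n → ℝ} (hr : RepOn U r f)
    (hs : RepOn U s g) : RepOn U (r + s) fun x => f x + g x := by
  obtain ⟨p, q, hq, rfl, hpq⟩ := hr
  obtain ⟨p', q', hq', rfl, hpq'⟩ := hs
  refine ⟨p * q' + q * p', q * q', mul_mem hq hq', ?_, fun x hx => ?_⟩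
  · rw [div_add_div _ _ (toRat_ne_zero (ne_zero_of_mem_linProds hq))
      (toRat_ne_zero (ne_zero_of_mem_linProds hq'))]
    simp
  · simp only [map_add, map_mul, hpq x hx, hpq' x hx]
    ring

theorem RepOn.neg {U : Set (E n)} {r : RatFun n} {f : E n → ℝ} (hr : RepOn U r f) :
    RepOn U (-r) fun x => -f x := by
  obtain ⟨p, q, hq, rfl, hpq⟩ := hr
  refine ⟨-p, q, hq, by rw [map_neg, neg_div], fun x hx => ?_⟩
  rw [map_neg, hpq x hx]
  ring

theorem repOn_zero (U : Set (E n)) : RepOn U 0 fun _ => 0 :=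
  ⟨0, 1, one_mem _, by simp, by simp⟩

theorem RepOn.sum {ι : Type*} (t : Finset ι) {U : Set (E n)} {r : ι → RatFun n}
    {f : ι → E n → ℝ} (h : ∀ i ∈ t, RepOn U (r i) (f i)) :
    RepOn U (∑ i ∈ t, r i) fun x => ∑ i ∈ t, f i x := by
  classical
  induction t using Finset.induction_on with
  | empty => simpa using repOn_zero U
  | insert a t ha ih =>
    simp only [Finset.sum_insert ha]
    exact (h a (by simp)).add (ih fun i hi => h i (by simp [hi]))

theorem RepOn.eq_zero {W : Set (E n)} {r : RatFun n} (h : RepOn W r fun _ => 0) (hW : IsOpen W)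
    (hne : W.Nonempty) : r = 0 := by
  obtain ⟨p, q, -, rfl, hpq⟩ := h
  have hp : p = 0 := eq_zero_of_ev_eq_zero hW hne fun x hx => by rw [hpq x hx, mul_zero]
  simp [hp]

theorem RepOn.extend {U W : Set (E n)} {r : RatFun n} {g : E n → ℝ} (h : RepOn W r g)
    (hg : LineAnalytic g U) (hU : Convex ℝ U) (hW : IsOpen W) (hne : (W ∩ U).Nonempty) :
    RepOn U r g := by
  obtain ⟨p, q, hq, hr, hpq⟩ := h
  refine ⟨p, q, hq, hr, fun x hx => sub_eq_zero.1 ?_⟩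
  exact ((lineAnalytic_ev p U).sub ((lineAnalytic_ev q U).mul hg)).eq_zero hU hW hne
    (fun y hy => sub_eq_zero.2 (hpq y hy)) x hx

theorem RepOn.hasValueAt {U : Set (E n)} {r : RatFun n} {g : E n → ℝ} (h : RepOn U r g)
    (hg : LineAnalytic g U) (hU : IsOpen U) {x : E n} (hx : x ∈ U) : HasValueAt r x (g x) := by
  obtain ⟨p, q, hq, rfl, hpq⟩ := h
  obtain ⟨p', q', h1, h2, h3⟩ := exists_regular_fraction hU hx hq p g hg hpq
  have hq' : q' ≠ 0 := by rintro rfl; simp at h1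
  refine ⟨p', q', h1, ?_, ?_⟩
  · rw [div_eq_div_iff (toRat_ne_zero (ne_zero_of_mem_linProds hq)) (toRat_ne_zero hq'),
      ← map_mul, ← map_mul, h2]
  · exact (eq_div_iff h1).2 ((mul_comm _ _).trans h3.symm)

theorem HasValueAt.ev_eq {r : RatFun n} {x : E n} {c : ℝ} (h : HasValueAt r x c) {p q : Pol n}
    (hq : q ≠ 0) (hr : r = toRat p / toRat q) : ev x p = ev x q * c := by
  obtain ⟨p', q', h1, h2, rfl⟩ := h
  have hq' : q' ≠ 0 := by rintro rfl; simp at h1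
  have h3 : p * q' = p' * q := by
    rw [hr, div_eq_div_iff (toRat_ne_zero hq) (toRat_ne_zero hq'), ← map_mul, ← map_mul] at h2
    exact IsFractionRing.injective (Pol n) (RatFun n) h2
  have h4 := congrArg (ev x) h3
  rw [map_mul, map_mul] at h4
  change ev x q' ≠ 0 at h1
  change ev x p = ev x q * (ev x p' / ev x q')
  field_simp
  linear_combination h4

/-- A rational function is determined by its values on a non-empty open set. -/
theorem eq_of_hasValueAt {r r' : RatFun n} {W : Set (E n)} (hW : IsOpen W) (hne : W.Nonempty)
    {g : E n → ℝ} (h : ∀ x ∈ W, HasValueAt r x (g x)) (h' : ∀ x ∈ W, HasValueAt r' x (g x)) :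
    r = r' := by
  obtain ⟨p, q, hq, hr⟩ := IsFractionRing.div_surjective (A := Pol n) r
  obtain ⟨p', q', hq', hr'⟩ := IsFractionRing.div_surjective (A := Pol n) r'
  have hq0 := nonZeroDivisors.ne_zero hq
  have hq0' := nonZeroDivisors.ne_zero hq'
  have : p * q' - p' * q = 0 := eq_zero_of_ev_eq_zero hW hne fun x hx => by
    rw [map_sub, map_mul, map_mul, (h x hx).ev_eq hq0 hr.symm, (h' x hx).ev_eq hq0' hr'.symm]
    ring
  rw [← hr, ← hr', div_eq_div_iff (toRat_ne_zero hq0) (toRat_ne_zero hq0'), ← map_mul, ← map_mul,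
    sub_eq_zero.1 this]

theorem HasValueAt.const_mul {r : RatFun n} {x : E n} {c : ℝ} (a : ℝ) (h : HasValueAt r x c) :
    HasValueAt (toRat (MvPolynomial.C a) * r) x (a * c) := by
  obtain ⟨p, q, h1, rfl, rfl⟩ := h
  refine ⟨MvPolynomial.C a * p, q, h1, ?_, ?_⟩
  · rw [map_mul, mul_div_assoc]
  · rw [map_mul, MvPolynomial.eval_C, mul_div_assoc]

/-! ### Exponential integrals -/

/-- The exponential integral `∫_A e^{-⟨x, u⟩} du`. -/
def expInt (A : Set (E n)) (x : E n) : ℝ := ∫ u in A, Real.exp (-(inner ℝ x u : ℝ))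

/-- The points at which the exponential integral over `A` converges. -/
def expDom (A : Set (E n)) : Set (E n) :=
  {x | IntegrableOn (fun u => Real.exp (-(inner ℝ x u : ℝ))) A}

theorem expDom_anti {A B : Set (E n)} (h : A ⊆ B) : expDom B ⊆ expDom A :=
  fun _ hx => IntegrableOn.mono_set hx h

theorem continuous_exp_inner (x : E n) :
    Continuous fun u : E n => Real.exp (-(inner ℝ x u : ℝ)) := by fun_prop

/-- This follows from convexity of `exp`. It lets the identity theorem along segments link any two
points of the interior of the domain of convergence. -/
theorem convex_expDom (A : Set (E n)) : Convex ℝ (expDom A) := by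
  intro x hx y hy a b ha hb hab
  have hint := (Integrable.const_mul hx a).add (Integrable.const_mul hy b)
  refine Integrable.mono' hint (continuous_exp_inner _).aestronglyMeasurable
    (Eventually.of_forall fun u => ?_)
  have := convexOn_exp.2 (Set.mem_univ (-(inner ℝ x u : ℝ))) (Set.mem_univ (-(inner ℝ y u : ℝ)))
    ha hb hab
  rw [Real.norm_eq_abs, Real.abs_exp]
  refine le_trans (le_of_eq ?_) this
  rw [inner_add_left, inner_smul_left, inner_smul_left]
  simp only [smul_eq_mul, conj_trivial]
  ring_nf

theorem integrable_exp_neg_mul_norm {c : ℝ} (hc : 0 < c) :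
    Integrable fun u : E n => Real.exp (-(c * ‖u‖)) := by
  have hr : (Module.finrank ℝ (E n) : ℝ) < ((n + 1 : ℕ) : ℝ) := by
    rw [finrank_euclideanSpace_fin]
    push_cast
    linarith
  have hm : (0 : ℝ) < ((n + 1 : ℕ) : ℝ) := by positivity
  set d : ℝ := c / ((n + 1 : ℕ) : ℝ) with hd
  have hd0 : 0 < d := by positivity
  have hint := (integrable_one_add_norm (E := E n) (μ := volume) hr).const_mul
    (Real.exp c * (d ^ (n + 1))⁻¹)
  refine Integrable.mono' hint (by fun_prop) (Eventually.of_forall fun u => ?_)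
  have hu : 0 < 1 + ‖u‖ := by positivity
  -- With `d = c / (n + 1)`, the power `n + 1` of this bound compares the exponential with `(1 +
  -- ‖u‖) ^ (-(n + 1))`, which is integrable in dimension `n`.
  have h1 : d * (1 + ‖u‖) ≤ Real.exp (d * (1 + ‖u‖)) := by
    linarith [Real.add_one_le_exp (d * (1 + ‖u‖))]
  have h2 := pow_le_pow_left₀ (by positivity) h1 (n + 1)
  rw [← Real.exp_nat_mul, mul_pow] at h2
  have h3 : ((n + 1 : ℕ) : ℝ) * (d * (1 + ‖u‖)) = c + c * ‖u‖ := by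
    rw [hd]; field_simp
  rw [h3, Real.exp_add] at h2
  rw [Real.norm_eq_abs, Real.abs_exp, Real.rpow_neg hu.le, Real.rpow_natCast, Real.exp_neg,
    mul_assoc, ← mul_inv, ← div_eq_mul_inv, le_div_iff₀ (by positivity), ← div_eq_inv_mul,
    div_le_iff₀ (by positivity)]
  exact h2

/-- An interior point `x` can be moved a fixed distance in the direction `-u` without leaving the
dual cone. -/
theorem exists_mul_norm_le {K : Set (E n)} {x : E n} (hx : x ∈ interior (dualCone K)) :
    ∃ c : ℝ, 0 < c ∧ ∀ u ∈ K, c * ‖u‖ ≤ inner ℝ x u := by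
  obtain ⟨ε, hε, hball⟩ := Metric.isOpen_iff.1 isOpen_interior x hx
  refine ⟨ε / 2, by positivity, fun u hu => ?_⟩
  rcases eq_or_ne u 0 with rfl | hu0
  · simp
  have hun : 0 < ‖u‖ := norm_pos_iff.2 hu0
  have hmem : x - (ε / 2 / ‖u‖) • u ∈ Metric.ball x ε := by
    rw [Metric.mem_ball, dist_eq_norm, sub_sub_cancel_left, norm_neg, norm_smul, Real.norm_eq_abs,
      abs_of_pos (by positivity)]
    field_simp
    linarith
  have h := interior_subset (hball hmem) u hu
  rw [inner_sub_left, inner_smul_left, real_inner_self_eq_norm_sq] at h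
  simp only [conj_trivial] at h
  have : ε / 2 / ‖u‖ * ‖u‖ ^ 2 = ε / 2 * ‖u‖ := by field_simp
  linarith

theorem inner_pos_of_mem_interior {K : Set (E n)} {x u : E n} (hx : x ∈ interior (dualCone K))
    (hu : u ∈ K) (hu0 : u ≠ 0) : (0 : ℝ) < inner ℝ x u := by
  obtain ⟨c, hc, h⟩ := exists_mul_norm_le hx
  have := norm_pos_iff.2 hu0
  exact lt_of_lt_of_le (by positivity) (h u hu)

theorem interior_dualCone_subset_expDom {K : Set (E n)} (hK : MeasurableSet K) :
    interior (dualCone K) ⊆ expDom K := by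
  intro x hx
  obtain ⟨c, hc, h⟩ := exists_mul_norm_le hx
  refine Integrable.mono' (integrable_exp_neg_mul_norm hc).integrableOn
    (continuous_exp_inner _).aestronglyMeasurable ?_
  filter_upwards [ae_restrict_mem hK] with u hu
  rw [Real.norm_eq_abs, Real.abs_exp]
  exact Real.exp_le_exp.2 (neg_le_neg (h u hu))

theorem interior_dualCone_subset_interior_expDom {K : Set (E n)} (hK : MeasurableSet K) :
    interior (dualCone K) ⊆ interior (expDom K) :=
  interior_maximal (interior_dualCone_subset_expDom hK) isOpen_interior

theorem convex_dualCone (K : Set (E n)) : Convex ℝ (dualCone K) := by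
  intro x hx y hy a b ha hb _ u hu
  rw [inner_add_left, inner_smul_left, inner_smul_left]
  exact add_nonneg (mul_nonneg ha (hx u hu)) (mul_nonneg hb (hy u hu))

/-- Along the line `x + t v` the integral is the moment generating function of `-⟨v, u⟩` under the
measure `e^{-⟨x, u⟩} du` on `A`, and such functions are analytic inside their domain. -/
theorem lineAnalytic_expInt (A : Set (E n)) : LineAnalytic (expInt A) (interior (expDom A)) := by
  intro x hx v
  set μ : Measure (E n) := (volume.restrict A).withDensity
    fun u => ENNReal.ofReal (Real.exp (-(inner ℝ x u : ℝ))) with hμ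
  have hmeas : Measurable fun u : E n => ENNReal.ofReal (Real.exp (-(inner ℝ x u : ℝ))) := by
    fun_prop
  have hfin : ∀ᵐ u ∂(volume.restrict A), ENNReal.ofReal (Real.exp (-(inner ℝ x u : ℝ))) < ⊤ :=
    Eventually.of_forall fun u => ENNReal.ofReal_lt_top
  have hfun : ∀ (t : ℝ) (u : E n), (ENNReal.ofReal (Real.exp (-(inner ℝ x u : ℝ)))).toReal •
      Real.exp (t * -(inner ℝ v u : ℝ)) = Real.exp (-(inner ℝ (x + t • v) u : ℝ)) := by
    intro t u
    rw [ENNReal.toReal_ofReal (Real.exp_nonneg _), smul_eq_mul, ← Real.exp_add, inner_add_left,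
      inner_smul_left]
    simp only [conj_trivial]
    ring_nf
  have hmgf : (fun t : ℝ => expInt A (x + t • v)) =
      ProbabilityTheory.mgf (fun u => -(inner ℝ v u : ℝ)) μ := by
    funext t
    rw [ProbabilityTheory.mgf, hμ, integral_withDensity_eq_integral_toReal_smul hmeas hfin]
    simp only [hfun]
    rfl
  have hset : ∀ t : ℝ, x + t • v ∈ expDom A →
      t ∈ ProbabilityTheory.integrableExpSet (fun u => -(inner ℝ v u : ℝ)) μ := by
    intro t ht
    change Integrable _ μ
    rw [hμ, integrable_withDensity_iff_integrable_smul' hmeas hfin]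
    simp only [hfun]
    exact ht
  rw [hmgf]
  refine ProbabilityTheory.analyticAt_mgf (mem_interior_iff_mem_nhds.2 ?_)
  filter_upwards [(tendsto_line x v).eventually (isOpen_interior.mem_nhds hx)] with t ht
  exact hset t (interior_subset ht)

theorem shift_mem_expDom {A : Set (E n)} {x : E n} (v : E n) (hx : x ∈ expDom A) :
    x ∈ expDom {u | u + v ∈ A} := by
  have h := ((measurePreserving_add_right (volume : Measure (E n)) v).integrableOn_comp_preimage
    (MeasurableEquiv.addRight v).measurableEmbedding).2 hx
  refine (Integrable.const_mul h (Real.exp (inner ℝ x v))).congr (Eventually.of_forall fun u => ?_)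
  simp only [Function.comp, ← Real.exp_add, inner_add_right]
  ring_nf

theorem expInt_shift (A : Set (E n)) (x v : E n) :
    expInt {u | u + v ∈ A} x = Real.exp (inner ℝ x v) * expInt A x := by
  have h := (measurePreserving_add_right (volume : Measure (E n)) v).setIntegral_preimage_emb
    (MeasurableEquiv.addRight v).measurableEmbedding
    (fun u => Real.exp (-(inner ℝ x u : ℝ))) A
  unfold expInt
  rw [← h, ← integral_const_mul]
  refine integral_congr_ae (Eventually.of_forall fun u => ?_)
  simp only [← Real.exp_add, inner_add_right]
  ring_nf

/-- If two sets `A` and `B` partition a set that is invariant under translation by `v`, and are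
stable under the translations by `-v` and `v`, respectively, then a rational function that gives
the exponential integral over `A` gives minus the exponential integral over `B`. -/
theorem RepOn.continuation {A B W : Set (E n)} {v : E n} {r : RatFun n}
    (h : RepOn W r (expInt A)) (hA : MeasurableSet A) (hB : MeasurableSet B)
    (hAv : ∀ u, u + v ∈ A → u ∈ A) (hBv : ∀ u ∈ B, u + v ∈ B) (hdisj : ∀ u ∈ A, u ∉ B)
    (hinv : ∀ u, (u + v ∈ A ∨ u + v ∈ B) ↔ (u ∈ A ∨ u ∈ B)) (hW : IsOpen W) (hne : W.Nonempty)
    (hWA : W ⊆ expDom A) :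
    RepOn {y | y ∈ interior (expDom B) ∧ (inner ℝ y v : ℝ) ≠ 0} (-r) (expInt B) := by
  obtain ⟨p, q, hq, hr, hpq⟩ := h
  have hshift : ∀ {S : Set (E n)}, MeasurableSet S → MeasurableSet {u | u + v ∈ S} := fun hS =>
    (measurable_add_const v) hS
  set D : Set (E n) := A \ {u | u + v ∈ A} with hD
  -- `D` is the slab of points of `A` whose translate by `v` lies in `B`, so it can be described
  -- from either side, and its integral converges wherever that of `A` or that of `B` does.
  have hD' : D = {u | u + v ∈ B} \ B := by
    ext u
    have := hinv u
    have := hdisj u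
    have := hdisj (u + v)
    simp only [hD, Set.mem_sdiff, Set.mem_ofPred_eq]
    tauto
  have hDA : ∀ x ∈ expDom A, expInt D x = (1 - Real.exp (inner ℝ x v)) * expInt A x := by
    intro x hx
    have : expInt D x = expInt A x - expInt {u | u + v ∈ A} x :=
      setIntegral_sdiff (hshift hA) hx hAv
    rw [this, expInt_shift]
    ring
  have hDB : ∀ y ∈ expDom B, expInt D y = (Real.exp (inner ℝ y v) - 1) * expInt B y := by
    intro y hy
    have : expInt ({u | u + v ∈ B} \ B) y = expInt {u | u + v ∈ B} y - expInt B y :=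
      setIntegral_sdiff hB (shift_mem_expDom v hy) hBv
    rw [hD', this, expInt_shift]
    ring
  have hAD : expDom A ⊆ expDom D := expDom_anti Set.sdiff_subset
  have hBD : expDom B ⊆ expDom D := by
    rw [hD']
    exact fun y hy => expDom_anti Set.sdiff_subset (shift_mem_expDom v hy)
  have hexp : ∀ V : Set (E n), LineAnalytic (fun x => ev x p * (1 - Real.exp (ev x (lin v)))) V :=
    fun V => (lineAnalytic_ev p V).mul fun x hx w =>
      analyticAt_const.sub (lineAnalytic_ev (lin v) V x hx w).rexp
  -- The identity `p (1 - e^{⟨x, v⟩}) = q · expInt D` holds on `W` by the computation over `A` and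
  -- continues to the interior of the convex set `expDom D`. There the computation over `B` applies,
  -- and the factor `e^{⟨y, v⟩} - 1` is cancelled.
  have key := ((hexp _).sub ((lineAnalytic_ev q _).mul (lineAnalytic_expInt D))).eq_zero
    (convex_expDom D).interior hW
    (by rwa [Set.inter_eq_left.2 (interior_maximal (hWA.trans hAD) hW)]) fun x hx => by
      rw [hpq x hx, ev_lin, hDA x (hWA hx)]
      ring
  refine ⟨-p, q, hq, by rw [hr, map_neg, neg_div], fun y hy => ?_⟩
  have h1 := key y (interior_mono hBD hy.1)
  rw [ev_lin, hDB y (interior_subset hy.1)] at h1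
  have h2 : Real.exp (inner ℝ y v) - 1 ≠ 0 := by
    rw [sub_ne_zero, Ne, Real.exp_eq_one_iff]
    exact hy.2
  rw [map_neg]
  refine mul_right_cancel₀ h2 ?_
  linear_combination h1

/-! ### Simplicial cones -/

/-- The cone generated by a family of vectors. -/
def coneOf (b : Fin n → E n) : Set (E n) :=
  {u | ∃ c : Fin n → ℝ, (∀ i, 0 ≤ c i) ∧ u = ∑ i, c i • b i}

/-- The linear map with columns `b`. -/
def comb (b : Fin n → E n) (c : Fin n → ℝ) : E n := ∑ i, c i • b i

theorem coneOf_eq_image (b : Fin n → E n) :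
    coneOf b = comb b '' Set.pi Set.univ fun _ => Set.Ici (0 : ℝ) := by
  ext u
  simp [coneOf, comb, eq_comm, Pi.le_def]

theorem integral_exp_neg_mul_Ici {a : ℝ} (ha : 0 < a) :
    a * ∫ t in Set.Ici (0 : ℝ), Real.exp (-(t * a)) = 1 := by
  rw [integral_Ici_eq_integral_Ioi]
  have := integral_exp_mul_Ioi (a := -a) (by linarith) 0
  simp only [mul_zero, Real.exp_zero] at this
  have h2 : ∀ t : ℝ, -(t * a) = -a * t := fun t => by ring
  simp only [h2, this]
  field_simp

theorem prod_mul_expInt_coneOf {b : Fin n → E n}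
    (hb : MeasurePreserving (comb b) volume volume) (hb' : MeasurableEmbedding (comb b))
    {x : E n} (hx : ∀ i, (0 : ℝ) < inner ℝ x (b i)) :
    (∏ i, (inner ℝ x (b i) : ℝ)) * expInt (coneOf b) x = 1 := by
  have h1 : expInt (coneOf b) x =
      ∏ i, ∫ t in Set.Ici (0 : ℝ), Real.exp (-(t * inner ℝ x (b i))) := by
    rw [expInt, coneOf_eq_image, hb.setIntegral_image_emb hb', volume_pi, Measure.restrict_pi_pi,
      ← integral_fintype_prod_eq_prod]
    refine integral_congr_ae (Eventually.of_forall fun c => ?_)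
    simp only [comb, inner_sum, inner_smul_right]
    rw [← Finset.sum_neg_distrib, Real.exp_sum]
  rw [h1, ← Finset.prod_mul_distrib]
  exact Finset.prod_eq_one fun i _ => integral_exp_neg_mul_Ici (hx i)

/-! ### Simple roots and fundamental weights -/

theorem e_apply (i k : Fin n) : (e i : E n) k = if k = i then 1 else 0 := by
  simp [e]

theorem inner_e (u : E n) (i : Fin n) : inner ℝ u (e i) = u i := by
  rw [e, EuclideanSpace.inner_single_right]
  simp

theorem sum_smul_e (u : E n) : ∑ i, u i • e i = u := by
  ext k
  simp [e_apply]

/-- The simple roots `e₁ - e₂, …, eₙ₋₁ - eₙ, eₙ`. -/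
def simpleRoot (i : Fin n) : E n := if h : i.1 + 1 < n then e i - e ⟨i.1 + 1, h⟩ else e i

/-- The vectors `e₁ + ⋯ + eᵢ`, which form the dual basis of the simple roots. -/
def weight (i : Fin n) : E n := ∑ j ∈ Finset.Iic i, e j

theorem weight_apply (i k : Fin n) : (weight i : E n) k = if k ≤ i then 1 else 0 := by
  simp [weight, e_apply]

theorem inner_weight (u : E n) (i : Fin n) : inner ℝ u (weight i) = ∑ j ∈ Finset.Iic i, u j := by
  simp [weight, inner_sum, inner_e]

theorem inner_simpleRoot (u : E n) (i : Fin n) :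
    inner ℝ u (simpleRoot i) = if h : i.1 + 1 < n then u i - u ⟨i.1 + 1, h⟩ else u i := by
  unfold simpleRoot
  split_ifs
  · rw [inner_sub_right, inner_e, inner_e]
  · rw [inner_e]

theorem sum_inner_simpleRoot_smul_weight (u : E n) :
    ∑ i, (inner ℝ u (simpleRoot i) : ℝ) • weight i = u := by
  ext k
  -- Setting `f n = 0` brings the last simple root `eₙ` into the form of the others, so that the sum
  -- telescopes.
  set f : ℕ → ℝ := fun m => if h : m < n then u ⟨m, h⟩ else 0 with hf
  have h1 : ∀ i : Fin n, inner ℝ u (simpleRoot i) = f i.1 - f (i.1 + 1) := by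
    intro i
    rw [inner_simpleRoot]
    simp only [hf, i.2, dif_pos, Fin.eta]
    split_ifs <;> simp
  have h2 : (∑ i, (inner ℝ u (simpleRoot i) : ℝ) • (weight i : E n)) k =
      ∑ i : Fin n, if k.1 ≤ i.1 then f i.1 - f (i.1 + 1) else 0 := by
    simp only [WithLp.ofLp_sum, Finset.sum_apply, WithLp.ofLp_smul, Pi.smul_apply, smul_eq_mul,
      weight_apply, h1, Fin.le_def, mul_ite, mul_one, mul_zero]
  rw [h2, Fin.sum_univ_eq_sum_range (fun m : ℕ => if k.1 ≤ m then f m - f (m + 1) else 0),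
    ← Finset.sum_filter]
  have h3 : (Finset.range n).filter (fun m => k.1 ≤ m) = Finset.Ico k.1 n := by
    ext m
    simp only [Finset.mem_filter, Finset.mem_range, Finset.mem_Ico]
    omega
  have h4 : ∑ m ∈ Finset.Ico k.1 n, (f m - f (m + 1)) = f k.1 - f n := by
    have := Finset.sum_Ico_sub f k.2.le
    rw [← neg_sub (f n), ← this, ← Finset.sum_neg_distrib]
    simp
  rw [h3, h4]
  simp [hf]

theorem sum_inner_weight_smul_simpleRoot (u : E n) :
    ∑ i, (inner ℝ u (weight i) : ℝ) • simpleRoot i = u := by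
  refine ext_inner_left ℝ fun v => ?_
  conv_rhs => rw [← sum_inner_simpleRoot_smul_weight v]
  rw [inner_sum, sum_inner]
  refine Finset.sum_congr rfl fun i _ => ?_
  rw [inner_smul_left, inner_smul_right, real_inner_comm u]
  simp only [conj_trivial]
  ring

theorem measurePreserving_comb {b : Fin n → E n}
    (hb : (Matrix.of fun k i => b i k).det = 1) : MeasurePreserving (comb b) volume volume := by
  set M : Matrix (Fin n) (Fin n) ℝ := Matrix.of fun k i => b i k with hM
  have h1 : comb b = WithLp.toLp 2 ∘ Matrix.toLin' M := by
    funext c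
    ext k
    simp [comb, hM, Matrix.mulVec, dotProduct, mul_comm]
  rw [h1]
  refine (PiLp.volume_preserving_toLp (Fin n)).comp ⟨?_, ?_⟩
  · exact (LinearMap.continuous_of_finiteDimensional _).measurable
  · rw [Real.map_matrix_volume_pi_eq_smul_volume_pi (by rw [hb]; exact one_ne_zero), hb]
    simp

theorem measurableEmbedding_comb {b : Fin n → E n}
    (hb : (Matrix.of fun k i => b i k).det = 1) : MeasurableEmbedding (comb b) := by
  set M : Matrix (Fin n) (Fin n) ℝ := Matrix.of fun k i => b i k with hM
  have hc : Continuous (comb b) := by unfold comb; fun_prop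
  refine hc.measurableEmbedding fun c d hcd => ?_
  have hinj : Function.Injective M.mulVec := Matrix.mulVec_injective_of_isUnit
    ((Matrix.isUnit_iff_isUnit_det M).2 (by rw [hb]; exact isUnit_one))
  refine hinj ?_
  funext k
  have := congrArg (fun u : E n => u k) hcd
  simpa [comb, hM, Matrix.mulVec, dotProduct, mul_comm] using this

theorem det_weight : (Matrix.of fun k i : Fin n => (weight i : E n) k).det = 1 := by
  rw [Matrix.det_of_isUpperTriangular]
  · simp [weight_apply]
  · intro i j hij
    simpa [weight_apply] using hij

/-- The simple roots and the `weight i` are dual bases, so their matrices are inverse up to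
transposition, and the matrix of the weights is unitriangular. -/
theorem det_simpleRoot : (Matrix.of fun k i : Fin n => (simpleRoot i : E n) k).det = 1 := by
  have h : (Matrix.of fun k i : Fin n => (simpleRoot i : E n) k) *
      (Matrix.of fun k i : Fin n => (weight i : E n) k).transpose = 1 := by
    ext k j
    have := congrArg (fun u : E n => u k) (sum_inner_weight_smul_simpleRoot (e j))
    rw [Matrix.mul_apply, Matrix.one_apply]
    simp only [WithLp.ofLp_sum, Finset.sum_apply, e_apply, WithLp.ofLp_smul, Pi.smul_apply,
      smul_eq_mul] at this
    simp only [Matrix.of_apply, Matrix.transpose_apply]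
    rw [← this]
    refine Finset.sum_congr rfl fun i _ => ?_
    rw [real_inner_comm, inner_e, mul_comm]
  have h2 := congrArg Matrix.det h
  rwa [Matrix.det_mul, Matrix.det_transpose, det_weight, mul_one, Matrix.det_one] at h2

/-! ### The action of signed permutations -/

theorem act_e (w : SignedPerm n) (i : Fin n) : act w (e i) = signedE (w.1 (1, i)) := by
  simp [act, e_apply]

theorem act_add (w : SignedPerm n) (x y : E n) : act w (x + y) = act w x + act w y := by
  simp [act, add_smul, Finset.sum_add_distrib]

theorem act_smul (w : SignedPerm n) (c : ℝ) (x : E n) : act w (c • x) = c • act w x := by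
  simp [act, mul_smul, Finset.smul_sum]

theorem signedE_one (i : Fin n) : (signedE (1, i) : E n) = e i := by simp [signedE]

theorem signedE_opp (p : PM n) : (signedE p.opp : E n) = -signedE p := by
  simp [signedE, PM.opp]

theorem signedE_neg_one (i : Fin n) : (signedE (-1, i) : E n) = -e i := by simp [signedE]

theorem inner_signedE (p q : PM n) : inner ℝ (signedE p : E n) (signedE q) =
    if p.2 = q.2 then ((p.1 : ℤ) : ℝ) * ((q.1 : ℤ) : ℝ) else 0 := by
  rw [signedE, signedE, inner_smul_left, inner_smul_right, inner_e, e_apply]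
  simp [eq_comm]

theorem act_signedE (w : SignedPerm n) (p : PM n) : act w (signedE p) = signedE (w.1 p) := by
  obtain ⟨s, i⟩ := p
  rw [signedE, act_smul, act_e]
  rcases Int.units_eq_one_or s with rfl | rfl
  · simp
  · have h : w.1 (-1, i) = (w.1 (1, i)).opp := w.2 (1, i)
    rw [h, signedE_opp]
    simp

theorem act_sum {ι : Type*} (w : SignedPerm n) (t : Finset ι) (f : ι → E n) :
    act w (∑ i ∈ t, f i) = ∑ i ∈ t, act w (f i) :=
  map_sum (⟨⟨act w, by simp [act]⟩, act_add w⟩ : E n →+ E n) f t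

theorem act_neg (w : SignedPerm n) (x : E n) : act w (-x) = -act w x := by
  rw [← neg_one_smul ℝ, act_smul, neg_one_smul]

theorem act_mul (w v : SignedPerm n) (x : E n) : act (w * v) x = act w (act v x) := by
  conv_rhs => rw [act.eq_1 v, act_sum]
  simp only [act_smul, act_signedE]
  rfl

theorem act_one (x : E n) : act 1 x = x := by
  conv_rhs => rw [← sum_smul_e x]
  simp [act, signedE_one]

theorem act_inv_act (w : SignedPerm n) (x : E n) : act w⁻¹ (act w x) = x := by
  rw [← act_mul, inv_mul_cancel, act_one]

theorem act_act_inv (w : SignedPerm n) (x : E n) : act w (act w⁻¹ x) = x := by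
  rw [← act_mul, mul_inv_cancel, act_one]

theorem snd_injective (w : SignedPerm n) {p q : PM n} (h : (w.1 p).2 = (w.1 q).2) : p.2 = q.2 := by
  have hw : w.1 q = w.1 p ∨ w.1 q = (w.1 p).opp := by
    rcases Int.units_eq_one_or (w.1 p).1 with h1 | h1 <;>
      rcases Int.units_eq_one_or (w.1 q).1 with h2 | h2
    · exact Or.inl (Prod.ext (h2.trans h1.symm) h.symm)
    · exact Or.inr (Prod.ext (by rw [PM.opp, h1, h2]) h.symm)
    · exact Or.inr (Prod.ext (by rw [PM.opp, h1, h2, neg_neg]) h.symm)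
    · exact Or.inl (Prod.ext (h2.trans h1.symm) h.symm)
  rcases hw with hw | hw
  · rw [w.1.injective hw]
  · rw [← w.2 p] at hw
    rw [w.1.injective hw]
    rfl

theorem inner_act (w : SignedPerm n) (x y : E n) :
    inner ℝ (act w x) (act w y) = (inner ℝ x y : ℝ) := by
  have h : ∀ i j, inner ℝ (signedE (w.1 (1, i)) : E n) (signedE (w.1 (1, j))) =
      if i = j then (1 : ℝ) else 0 := by
    intro i j
    rw [inner_signedE]
    by_cases hij : i = j
    · subst hij
      rcases Int.units_eq_one_or (w.1 (1, i)).1 with h1 | h1 <;> simp [h1]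
    · rw [if_neg hij, if_neg fun h => hij (snd_injective w h)]
  simp only [act, sum_inner, inner_sum, inner_smul_left, inner_smul_right, h]
  simp [PiLp.inner_apply, mul_comm]

theorem inner_act_left (w : SignedPerm n) (x y : E n) :
    inner ℝ (act w x) y = (inner ℝ x (act w⁻¹ y) : ℝ) := by
  rw [← inner_act w x, act_act_inv]

/-- The action of a signed permutation as a linear isometry. -/
def actEquiv (w : SignedPerm n) : E n ≃ₗᵢ[ℝ] E n where
  toFun := act w
  invFun := act w⁻¹
  map_add' := act_add w
  map_smul' := act_smul w
  left_inv := act_inv_act w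
  right_inv := act_act_inv w
  norm_map' x := by
    change ‖act w x‖ = ‖x‖
    rw [norm_eq_sqrt_real_inner, inner_act, ← norm_eq_sqrt_real_inner]

theorem comb_act (w : SignedPerm n) (b : Fin n → E n) :
    comb (fun i => act w (b i)) = actEquiv w ∘ comb b := by
  funext c
  change _ = act w _
  simp [comb, act_sum, act_smul]

theorem coneOf_act (w : SignedPerm n) (b : Fin n → E n) :
    coneOf (fun i => act w (b i)) = {u | act w⁻¹ u ∈ coneOf b} := by
  ext u
  simp only [coneOf, Set.mem_ofPred_eq]
  refine exists_congr fun c => and_congr_right fun _ => ?_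
  have : ∑ i, c i • act w (b i) = act w (∑ i, c i • b i) := by simp [act_sum, act_smul]
  rw [this]
  constructor
  · rintro rfl; rw [act_inv_act]
  · intro h; rw [← h, act_act_inv]

theorem prod_mul_expInt_coneOf_act {b : Fin n → E n} (hb : (Matrix.of fun k i => b i k).det = 1)
    (w : SignedPerm n) {x : E n} (hx : ∀ i, (0 : ℝ) < inner ℝ x (act w (b i))) :
    (∏ i, (inner ℝ x (act w (b i)) : ℝ)) * expInt (coneOf fun i => act w (b i)) x = 1 := by
  refine prod_mul_expInt_coneOf ?_ ?_ hx
  · rw [comb_act]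
    exact (actEquiv w).measurePreserving.comp (measurePreserving_comb hb)
  · rw [comb_act]
    exact (actEquiv w).toMeasurableEquiv.measurableEmbedding.comp (measurableEmbedding_comb hb)

/-! ### Roots -/

theorem e_add_e_mem {i j : Fin n} (h : i ≠ j) : e i + e j ∈ posRootsB n :=
  Or.inl (Or.inl ⟨i, j, h, rfl⟩)

theorem e_sub_e_mem {i j : Fin n} (h : i < j) : e i - e j ∈ posRootsB n :=
  Or.inl (Or.inr ⟨i, j, h, rfl⟩)

theorem e_mem (i : Fin n) : e i ∈ posRootsB n := Or.inr ⟨i, rfl⟩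

theorem simpleRoot_mem (i : Fin n) : simpleRoot i ∈ posRootsB n := by
  unfold simpleRoot
  split_ifs with h
  · exact e_sub_e_mem (by simp [Fin.lt_def])
  · exact e_mem i

theorem mem_rootsB_iff {v : E n} : v ∈ rootsB n ↔
    (∃ p q : PM n, p.2 ≠ q.2 ∧ v = signedE p + signedE q) ∨ ∃ p : PM n, v = signedE p := by
  constructor
  · rintro (⟨i, j, hij, h | h | h | h⟩ | ⟨i, h | h⟩)
    · exact Or.inl ⟨(1, i), (1, j), hij, by simp [h, signedE]⟩
    · exact Or.inl ⟨(1, i), (-1, j), hij, by simp [h, signedE, sub_eq_add_neg]⟩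
    · exact Or.inl ⟨(-1, i), (1, j), hij, by simp [h, signedE]⟩
    · exact Or.inl ⟨(-1, i), (-1, j), hij, by simp [h, signedE, sub_eq_add_neg]⟩
    · exact Or.inr ⟨(1, i), by simp [h, signedE]⟩
    · exact Or.inr ⟨(-1, i), by simp [h, signedE]⟩
  · rintro (⟨⟨s, i⟩, ⟨t, j⟩, hij, rfl⟩ | ⟨⟨s, i⟩, rfl⟩)
    · refine Or.inl ⟨i, j, hij, ?_⟩
      rcases Int.units_eq_one_or s with rfl | rfl <;> rcases Int.units_eq_one_or t with rfl | rfl <;>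
        simp [signedE, sub_eq_add_neg]
    · refine Or.inr ⟨i, ?_⟩
      rcases Int.units_eq_one_or s with rfl | rfl <;> simp [signedE]

theorem act_mem_rootsB (w : SignedPerm n) {v : E n} (hv : v ∈ rootsB n) : act w v ∈ rootsB n := by
  rw [mem_rootsB_iff] at hv ⊢
  rcases hv with ⟨p, q, hpq, rfl⟩ | ⟨p, rfl⟩
  · exact Or.inl ⟨w.1 p, w.1 q, fun h => hpq (snd_injective w h), by
      rw [act_add, act_signedE, act_signedE]⟩
  · exact Or.inr ⟨w.1 p, act_signedE w p⟩

theorem neg_mem_rootsB {v : E n} (hv : v ∈ rootsB n) : -v ∈ rootsB n := by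
  rw [mem_rootsB_iff] at hv ⊢
  rcases hv with ⟨p, q, hpq, rfl⟩ | ⟨p, rfl⟩
  · exact Or.inl ⟨p.opp, q.opp, hpq, by rw [signedE_opp, signedE_opp]; abel⟩
  · exact Or.inr ⟨p.opp, (signedE_opp p).symm⟩

theorem ne_zero_of_mem_rootsB {v : E n} (hv : v ∈ rootsB n) : v ≠ 0 := by
  have hs : ∀ p : PM n, inner ℝ (signedE p : E n) (signedE p) = (1 : ℝ) := by
    intro p
    rw [inner_signedE, if_pos rfl]
    rcases Int.units_eq_one_or p.1 with h | h <;> simp [h]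
  rintro rfl
  rcases mem_rootsB_iff.1 hv with ⟨p, q, hpq, h⟩ | ⟨p, h⟩
  · have h1 := congrArg (fun u : E n => (inner ℝ u (signedE p) : ℝ)) h
    simp only [inner_zero_left, inner_add_left, hs] at h1
    rw [inner_signedE, if_neg hpq.symm] at h1
    norm_num at h1
  · have := hs p
    rw [← h] at this
    simp at this

theorem posRootsB_subset : posRootsB n ⊆ rootsB n := by
  rintro v ((⟨i, j, hij, h⟩ | ⟨i, j, hij, h⟩) | ⟨i, h⟩)
  · exact Or.inl ⟨i, j, hij, Or.inl h⟩
  · exact Or.inl ⟨i, j, hij.ne, Or.inr (Or.inl h)⟩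
  · exact Or.inr ⟨i, Or.inl h⟩

theorem mem_or_neg_mem {v : E n} (hv : v ∈ rootsB n) : v ∈ posRootsB n ∨ -v ∈ posRootsB n := by
  rcases hv with ⟨i, j, hij, h | h | h | h⟩ | ⟨i, h | h⟩
  · exact Or.inl (h ▸ e_add_e_mem hij)
  · rcases lt_or_gt_of_ne hij with hlt | hlt
    · exact Or.inl (h ▸ e_sub_e_mem hlt)
    · refine Or.inr ?_
      rw [h, neg_sub]
      exact e_sub_e_mem hlt
  · rcases lt_or_gt_of_ne hij with hlt | hlt
    · refine Or.inr ?_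
      have : -v = e i - e j := by rw [h]; abel
      rw [this]
      exact e_sub_e_mem hlt
    · refine Or.inl ?_
      have : v = e j - e i := by rw [h]; abel
      rw [this]
      exact e_sub_e_mem hlt
  · refine Or.inr ?_
    have : -v = e i + e j := by rw [h]; abel
    rw [this]
    exact e_add_e_mem hij
  · exact Or.inl (h ▸ e_mem i)
  · refine Or.inr ?_
    rw [h, neg_neg]
    exact e_mem i

theorem finite_rootsB : (rootsB n).Finite := by
  have : rootsB n ⊆ Set.range (fun x : PM n × PM n => (signedE x.1 + signedE x.2 : E n)) ∪
      Set.range fun p : PM n => (signedE p : E n) := by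
    intro v hv
    rcases mem_rootsB_iff.1 hv with ⟨p, q, -, rfl⟩ | ⟨p, rfl⟩
    · exact Or.inl ⟨(p, q), rfl⟩
    · exact Or.inr ⟨p, rfl⟩
  exact ((Set.finite_range _).union (Set.finite_range _)).subset this

theorem span_rootsB : Submodule.span ℝ (rootsB n) = ⊤ := by
  refine eq_top_iff.2 fun u _ => ?_
  rw [← sum_smul_e u]
  exact Submodule.sum_mem _ fun i _ => Submodule.smul_mem _ _
    (Submodule.subset_span (posRootsB_subset (e_mem i)))

theorem inner_weight_nonneg {v : E n} (hv : v ∈ posRootsB n) (i : Fin n) :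
    (0 : ℝ) ≤ inner ℝ v (weight i) := by
  have he : ∀ j, inner ℝ (e j) (weight i) = if j ≤ i then (1 : ℝ) else 0 := fun j => by
    rw [real_inner_comm, inner_e, weight_apply]
  rcases hv with (⟨j, k, hjk, rfl⟩ | ⟨j, k, hjk, rfl⟩) | ⟨j, rfl⟩
  · rw [inner_add_left, he, he]
    split_ifs <;> norm_num
  · rw [inner_sub_left, he, he]
    by_cases hk : k ≤ i
    · rw [if_pos hk, if_pos (hjk.le.trans hk)]
      simp
    · rw [if_neg hk]
      split_ifs <;> norm_num
  · rw [he]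
    split_ifs <;> norm_num

theorem coneOf_simpleRoot :
    coneOf (simpleRoot : Fin n → E n) = {u | ∀ i, 0 ≤ (inner ℝ u (weight i) : ℝ)} := by
  ext u
  constructor
  · rintro ⟨c, hc, rfl⟩ i
    rw [sum_inner]
    refine Finset.sum_nonneg fun j _ => ?_
    rw [inner_smul_left]
    exact mul_nonneg (hc j) (inner_weight_nonneg (simpleRoot_mem j) i)
  · exact fun h => ⟨_, h, (sum_inner_weight_smul_simpleRoot u).symm⟩

/-! ### Dominant vectors -/

/-- Strictly dominant vectors. -/
def IsDominant (x : E n) : Prop := ∀ i, (0 : ℝ) < inner ℝ x (simpleRoot i)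

theorem IsDominant.inner_pos {x v : E n} (hx : IsDominant x) (hv : v ∈ posRootsB n) :
    (0 : ℝ) < inner ℝ x v := by
  rw [← sum_inner_weight_smul_simpleRoot v, inner_sum]
  simp only [inner_smul_right]
  have hnn : ∀ i ∈ Finset.univ, (0 : ℝ) ≤ inner ℝ v (weight i) * inner ℝ x (simpleRoot i) :=
    fun i _ => mul_nonneg (inner_weight_nonneg hv i) (hx i).le
  refine lt_of_le_of_ne (Finset.sum_nonneg hnn) fun h => ?_
  refine ne_zero_of_mem_rootsB (posRootsB_subset hv) ?_
  rw [← sum_inner_weight_smul_simpleRoot v]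
  refine Finset.sum_eq_zero fun i hi => ?_
  have := (Finset.sum_eq_zero_iff_of_nonneg hnn).1 h.symm i hi
  rw [(mul_eq_zero.1 this).resolve_right (hx i).ne', zero_smul]

theorem inner_nonneg_of_weakly_dominant {x v : E n} (hx : ∀ i, (0 : ℝ) ≤ inner ℝ x (simpleRoot i))
    (hv : v ∈ posRootsB n) : (0 : ℝ) ≤ inner ℝ x v := by
  rw [← sum_inner_weight_smul_simpleRoot v, inner_sum]
  simp only [inner_smul_right]
  exact Finset.sum_nonneg fun i _ => mul_nonneg (inner_weight_nonneg hv i) (hx i)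

/-- The strictly dominant vector `(n, n - 1, …, 1)`. -/
def rho (n : ℕ) : E n := WithLp.toLp 2 fun i => (n : ℝ) - (i.1 : ℝ)

theorem isDominant_rho : IsDominant (rho n) := by
  intro i
  rw [inner_simpleRoot]
  split_ifs
  · simp [rho]
  · simp [rho]

/-- Positive roots are those positive on a strictly dominant vector. This turns linear extensions
into sign conditions on `act w x`, that is, into chambers. -/
theorem mem_act_image_iff {w : SignedPerm n} {x v : E n} (hx : IsDominant x) (hv : v ∈ rootsB n) :
    v ∈ act w '' posRootsB n ↔ (0 : ℝ) < inner ℝ (act w x) v := by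
  rw [inner_act_left]
  have hv' : act w⁻¹ v ∈ rootsB n := act_mem_rootsB _ hv
  have : v ∈ act w '' posRootsB n ↔ act w⁻¹ v ∈ posRootsB n :=
    ⟨by rintro ⟨u, hu, rfl⟩; rwa [act_inv_act], fun h => ⟨_, h, act_act_inv w v⟩⟩
  rw [this]
  refine ⟨hx.inner_pos, fun h => (mem_or_neg_mem hv').resolve_right fun h' => ?_⟩
  have := hx.inner_pos h'
  rw [inner_neg_right] at this
  linarith

theorem mem_linearExtensions_iff {S : Set (E n)} (hS : S ⊆ rootsB n) {w : SignedPerm n} {x : E n}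
    (hx : IsDominant x) :
    w ∈ linearExtensions (posRootsB n) S ↔ ∀ v ∈ S, (0 : ℝ) < inner ℝ (act w x) v :=
  forall₂_congr fun _ hv => mem_act_image_iff hx (hS hv)

/-- The signed permutation `i ↦ σᵢ π(i)`. -/
def ofPermSign (π : Equiv.Perm (Fin n)) (σ : Fin n → ℤˣ) : SignedPerm n :=
  ⟨{ toFun := fun p => (p.1 * σ p.2, π p.2)
     invFun := fun p => (p.1 * σ (π.symm p.2), π.symm p.2)
     left_inv := fun p => by
      ext
      · simp [mul_assoc]
      · simp
     right_inv := fun p => by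
      ext
      · simp [mul_assoc]
      · simp },
    fun p => by simp [PM.opp]⟩

theorem exists_act_eq (ξ : E n) :
    ∃ (w : SignedPerm n) (η : E n), (∀ i, (0 : ℝ) ≤ inner ℝ η (simpleRoot i)) ∧ act w η = ξ := by
  -- `Tuple.sort` sorts in increasing order; the minus sign makes the absolute values decrease, as
  -- dominance requires.
  set f : Fin n → ℝ := fun i => -|ξ i| with hf
  set π := Tuple.sort f with hπ
  have hmono : Monotone (f ∘ π) := Tuple.monotone_sort f
  refine ⟨ofPermSign π fun i => if 0 ≤ ξ (π i) then 1 else -1, WithLp.toLp 2 fun i => |ξ (π i)|,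
    fun i => ?_, ?_⟩
  · rw [inner_simpleRoot]
    split_ifs with h
    · have := hmono (show i ≤ ⟨i.1 + 1, h⟩ by simp [Fin.le_def])
      simp only [hf, Function.comp] at this
      simp only
      linarith
    · exact abs_nonneg _
  · have h1 : ∀ i, |ξ (π i)| • (signedE ((if 0 ≤ ξ (π i) then 1 else -1 : ℤˣ), π i) : E n) =
        ξ (π i) • e (π i) := by
      intro i
      split_ifs with h
      · rw [abs_of_nonneg h, signedE_one]
      · rw [abs_of_neg (not_le.1 h), signedE_neg_one, neg_smul_neg]
    have h2 : act (ofPermSign π fun i => if 0 ≤ ξ (π i) then 1 else -1)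
        (WithLp.toLp 2 fun i => |ξ (π i)|) = ∑ i, ξ (π i) • e (π i) := by
      refine Finset.sum_congr rfl fun i _ => ?_
      rw [← h1 i]
      simp [ofPermSign]
    rw [h2, Equiv.sum_comp π fun i => ξ i • e i, sum_smul_e]

theorem linearExtensions_nonempty {S : Set (E n)} (hS : S ⊆ rootsB n) {ξ : E n}
    (hξ : ∀ v ∈ S, (0 : ℝ) < inner ℝ ξ v) : (linearExtensions (posRootsB n) S).Nonempty := by
  obtain ⟨w, η, hη, rfl⟩ := exists_act_eq ξ
  refine ⟨w, fun v hv => ⟨act w⁻¹ v, ?_, act_act_inv w v⟩⟩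
  -- `η` is only weakly dominant, so a positive root may pair to zero with it; the strict positivity
  -- of `ξ` on `S` excludes negative roots.
  refine (mem_or_neg_mem (act_mem_rootsB _ (hS hv))).resolve_right fun h => ?_
  have h1 := inner_nonneg_of_weakly_dominant hη h
  have h2 := hξ v hv
  rw [inner_act_left] at h2
  rw [inner_neg_right] at h1
  linarith

/-- Coordinates of a strictly dominant vector are positive and strictly decreasing. Positivity
forces all signs of `u` to be 1, and monotonicity forces its permutation to preserve the order. -/
theorem eq_one_of_isDominant {u : SignedPerm n} {x : E n} (hx : IsDominant x)
    (hux : IsDominant (act u x)) : u = 1 := by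
  have hpos : ∀ {y : E n}, IsDominant y → ∀ i, 0 < y i := fun hy i => by
    simpa [inner_e] using hy.inner_pos (e_mem i)
  have hanti : ∀ {y : E n}, IsDominant y → ∀ {i j}, i < j → y j < y i := fun hy i j hij => by
    have := hy.inner_pos (e_sub_e_mem hij)
    rw [inner_sub_right, inner_e, inner_e] at this
    linarith
  have hcoord : ∀ i, (act u x) (u.1 (1, i)).2 = (((u.1 (1, i)).1 : ℤ) : ℝ) * x i := by
    intro i
    have h1 : inner ℝ (act u x) (signedE (u.1 (1, i))) = x i := by
      rw [← act_e, inner_act, inner_e]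
    rw [signedE, inner_smul_right, inner_e] at h1
    rw [← h1]
    rcases Int.units_eq_one_or (u.1 (1, i)).1 with h | h <;> simp [h]
  have hsign : ∀ i, (u.1 (1, i)).1 = 1 := by
    intro i
    refine (Int.units_eq_one_or _).resolve_right fun h => ?_
    have h1 := hcoord i
    have h2 := hpos hux (u.1 (1, i)).2
    have h3 := hpos hx i
    rw [h1, h] at h2
    simp at h2
    linarith
  have hmono : StrictMono fun i => (u.1 (1, i)).2 := by
    intro i j hij
    by_contra hle
    have h1 := hanti hx hij
    have h2 : (act u x) (u.1 (1, i)).2 ≤ (act u x) (u.1 (1, j)).2 := by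
      rcases (not_lt.1 hle).lt_or_eq with h | h
      · exact (hanti hux h).le
      · exact le_of_eq (congrArg _ h.symm)
    rw [hcoord, hcoord, hsign, hsign] at h2
    simp at h2
    linarith
  have hid : ∀ i, (u.1 (1, i)).2 = i := by
    have hsurj : Function.Surjective fun i => (u.1 (1, i)).2 :=
      Finite.surjective_of_injective hmono.injective
    have h1 : StrictMono.orderIsoOfSurjective _ hmono hsurj = OrderIso.refl (Fin n) :=
      Subsingleton.elim _ _
    intro i
    exact congrArg (fun f : Fin n ≃o Fin n => f i) h1
  refine Subtype.ext (Equiv.ext fun p => ?_)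
  have h1 : ∀ i, u.1 (1, i) = (1, i) := fun i => Prod.ext (hsign i) (hid i)
  obtain ⟨s, i⟩ := p
  rcases Int.units_eq_one_or s with rfl | rfl
  · exact h1 i
  · have h : u.1 (-1, i) = (u.1 (1, i)).opp := u.2 (1, i)
    rw [h, h1]
    rfl

theorem eq_of_isDominant {w w' : SignedPerm n} {x : E n} (h : IsDominant (act w⁻¹ x))
    (h' : IsDominant (act w'⁻¹ x)) : w = w' := by
  have : w'⁻¹ * w = 1 := eq_one_of_isDominant h (by rwa [act_mul, act_act_inv])
  exact (inv_mul_eq_one.1 this).symm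

/-! ### Signed permutations acting on rational functions -/

theorem eq_of_ev_eq {p q : Pol n} (h : ∀ x, ev x p = ev x q) : p = q :=
  sub_eq_zero.1 (eq_zero_of_ev_eq_zero isOpen_univ Set.univ_nonempty fun x _ => by
    rw [map_sub, h, sub_self])

theorem ev_X (x : E n) (i : Fin n) : ev x (MvPolynomial.X i) = x i := by simp [ev]

theorem ev_C (x : E n) (a : ℝ) : ev x (MvPolynomial.C a) = a := by simp [ev]

theorem polHom_lin (w : SignedPerm n) (v : E n) : polHom w (lin v) = lin (act w v) := by
  refine eq_of_ev_eq fun x => ?_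
  have h : ∀ i, ev x (signedX (w.1 (1, i))) = inner ℝ x (signedE (w.1 (1, i))) := by
    intro i
    rw [signedE, inner_smul_right, inner_e, signedX, map_mul, ev_X, map_intCast]
  have h2 : ∀ i, ev x (polHom w (MvPolynomial.C (v i))) = v i := by
    intro i
    rw [← MvPolynomial.algebraMap_eq, AlgHom.commutes, MvPolynomial.algebraMap_eq, ev_C]
  rw [ev_lin, lin, map_sum, map_sum, act, inner_sum]
  refine Finset.sum_congr rfl fun i _ => ?_
  rw [map_mul, map_mul, h2, inner_smul_right, ← h]
  simp [polHom]

theorem ratAct_toRat (w : SignedPerm n) (p : Pol n) : ratAct w (toRat p) = toRat (polHom w p) :=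
  IsFractionRing.ringEquivOfRingEquiv_algebraMap _ p

theorem ratAct_one_div_prod_lin (w : SignedPerm n) (b : Fin n → E n) :
    ratAct w (1 / toRat (∏ i, lin (b i))) = 1 / toRat (∏ i, lin (act w (b i))) := by
  rw [map_div₀, map_one, ratAct_toRat, map_prod]
  simp only [polHom_lin]

theorem psiDenB_eq : psiDenB n = ∏ i, lin (simpleRoot i) := by
  refine Finset.prod_congr rfl fun i _ => eq_of_ev_eq fun x => ?_
  rw [ev_lin, inner_simpleRoot]
  split_ifs
  · rw [map_sub, ev_X, ev_X]
  · rw [ev_X]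

theorem phiDenB_eq : phiDenB n = ∏ i, lin (weight i) := by
  refine Finset.prod_congr rfl fun i _ => eq_of_ev_eq fun x => ?_
  rw [ev_lin, inner_weight, map_sum]
  simp only [ev_X]

theorem act_ne_zero (w : SignedPerm n) {v : E n} (hv : v ≠ 0) : act w v ≠ 0 := by
  intro h
  have := act_inv_act w v
  rw [h] at this
  exact hv (by simpa [act] using this.symm)

theorem simpleRoot_ne_zero (i : Fin n) : (simpleRoot i : E n) ≠ 0 :=
  ne_zero_of_mem_rootsB (posRootsB_subset (simpleRoot_mem i))

theorem weight_ne_zero (i : Fin n) : (weight i : E n) ≠ 0 := by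
  intro h
  have := weight_apply i i
  rw [h] at this
  simp at this

theorem repOn_ratAct {b : Fin n → E n} (hb : (Matrix.of fun k i => b i k).det = 1)
    (hb0 : ∀ i, b i ≠ 0) (w : SignedPerm n) {U : Set (E n)}
    (hU : ∀ x ∈ U, ∀ i, (0 : ℝ) < inner ℝ x (act w (b i))) :
    RepOn U (ratAct w (1 / toRat (∏ i, lin (b i)))) (expInt (coneOf fun i => act w (b i))) := by
  refine ⟨1, ∏ i, lin (act w (b i)),
    prod_mem fun i _ => lin_mem_linProds (act_ne_zero w (hb0 i)), ?_, fun x hx => ?_⟩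
  · rw [ratAct_one_div_prod_lin, map_one]
  · rw [map_one, map_prod]
    simp only [ev_lin]
    exact (prod_mul_expInt_coneOf_act hb w (hU x hx)).symm

theorem sumOver_union {L L₁ L₂ : Set (SignedPerm n)} (D : Pol n) (hL : L = L₁ ∪ L₂)
    (hd : Disjoint L₁ L₂) : sumOver L D = sumOver L₁ D + sumOver L₂ D := by
  classical
  subst hL
  unfold sumOver
  rw [← Finset.sum_union]
  · refine Finset.sum_congr ?_ fun _ _ => rfl
    ext w
    simp
  · rw [Finset.disjoint_left]
    intro w h1 h2
    simp only [Finset.mem_filter, Finset.mem_univ, true_and] at h1 h2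
    exact Set.disjoint_left.1 hd h1 h2

theorem sumOver_singleton (w : SignedPerm n) (D : Pol n) :
    sumOver {w} D = ratAct w (1 / toRat D) := by
  classical
  unfold sumOver
  rw [← Finset.sum_singleton (fun w => ratAct w (1 / toRat D)) w]
  refine Finset.sum_congr ?_ fun _ _ => rfl
  ext v
  simp

theorem linearExtensions_split {S : Set (E n)} (hS : S ⊆ rootsB n) {α : E n}
    (hα : α ∈ rootsB n) :
    linearExtensions (posRootsB n) S = linearExtensions (posRootsB n) (insert α S) ∪
        linearExtensions (posRootsB n) (insert (-α) S) ∧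
      Disjoint (linearExtensions (posRootsB n) (insert α S))
        (linearExtensions (posRootsB n) (insert (-α) S)) := by
  have h1 : insert α S ⊆ rootsB n := Set.insert_subset hα hS
  have h2 : insert (-α) S ⊆ rootsB n := Set.insert_subset (neg_mem_rootsB hα) hS
  have hsign : ∀ w : SignedPerm n, (0 : ℝ) < inner ℝ (act w (rho n)) α ∨
      (0 : ℝ) < inner ℝ (act w (rho n)) (-α) := by
    intro w
    rcases mem_or_neg_mem (act_mem_rootsB w⁻¹ hα) with h | h
    · rw [inner_act_left]
      exact Or.inl (isDominant_rho.inner_pos h)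
    · rw [inner_act_left w _ (-α), act_neg]
      exact Or.inr (isDominant_rho.inner_pos h)
  constructor
  · ext w
    rw [Set.mem_union, mem_linearExtensions_iff hS isDominant_rho,
      mem_linearExtensions_iff h1 isDominant_rho, mem_linearExtensions_iff h2 isDominant_rho]
    simp only [Set.forall_mem_insert]
    have := hsign w
    tauto
  · rw [Set.disjoint_left]
    intro w hw1 hw2
    rw [mem_linearExtensions_iff h1 isDominant_rho] at hw1
    rw [mem_linearExtensions_iff h2 isDominant_rho] at hw2
    have h3 := hw1 α (Set.mem_insert _ _)
    have h4 := hw2 (-α) (Set.mem_insert _ _)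
    rw [inner_neg_right] at h4
    linarith

/-! ### Positive spans -/

theorem mem_posSpan {S : Set (E n)} {v : E n} (hv : v ∈ S) : v ∈ posSpan S :=
  Submodule.subset_span hv

theorem posSpan_mono {S T : Set (E n)} (h : S ⊆ T) : posSpan S ⊆ posSpan T :=
  Submodule.span_mono h

theorem add_mem_posSpan {S : Set (E n)} {u v : E n} (hu : u ∈ posSpan S) (hv : v ∈ posSpan S) :
    u + v ∈ posSpan S :=
  Submodule.add_mem _ hu hv

theorem smul_mem_posSpan {S : Set (E n)} {u : E n} {c : ℝ} (hc : 0 ≤ c) (hu : u ∈ posSpan S) :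
    c • u ∈ posSpan S :=
  Submodule.smul_mem _ (⟨c, hc⟩ : NNReal) hu

theorem mem_posSpan_insert {S : Set (E n)} {α u : E n} :
    u ∈ posSpan (insert α S) ↔ ∃ a : ℝ, 0 ≤ a ∧ ∃ k ∈ posSpan S, u = a • α + k := by
  constructor
  · intro h
    obtain ⟨a, k, hk, rfl⟩ := Submodule.mem_span_insert.1 h
    exact ⟨a, a.2, k, hk, rfl⟩
  · rintro ⟨a, ha, k, hk, rfl⟩
    exact add_mem_posSpan (smul_mem_posSpan ha (mem_posSpan (Set.mem_insert _ _)))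
      (posSpan_mono (Set.subset_insert _ _) hk)

theorem inner_posSpan_nonneg {S : Set (E n)} {x : E n} (h : ∀ v ∈ S, (0 : ℝ) ≤ inner ℝ x v)
    {u : E n} (hu : u ∈ posSpan S) : (0 : ℝ) ≤ inner ℝ x u := by
  induction hu using Submodule.span_induction with
  | mem v hv => exact h v hv
  | zero => simp
  | add u v _ _ hu hv => rw [inner_add_right]; exact add_nonneg hu hv
  | smul a u _ hu =>
    rw [NNReal.smul_def, inner_smul_right]
    exact mul_nonneg a.2 hu

theorem mem_interior_dualCone_posSpan {S : Set (E n)} (hS : S.Finite) {x : E n}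
    (hx : ∀ v ∈ S, (0 : ℝ) < inner ℝ x v) : x ∈ interior (dualCone (posSpan S)) := by
  have hopen : IsOpen (⋂ v ∈ S, {y : E n | (0 : ℝ) < inner ℝ y v}) :=
    hS.isOpen_biInter fun v _ => isOpen_lt continuous_const (by fun_prop)
  refine interior_maximal (fun y hy u hu => ?_) hopen (Set.mem_iInter₂.2 hx)
  exact inner_posSpan_nonneg (fun v hv => (Set.mem_iInter₂.1 hy v hv).le) hu

theorem measurableSet_posSpan {S : Set (E n)} (hS : S.Finite) : MeasurableSet (posSpan S) := by
  have := hS.fintype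
  let f : (S → NNReal) → E n := fun c => ∑ v : S, c v • (v : E n)
  have hf : Continuous f := by fun_prop
  have h : posSpan S = f '' Set.univ := by
    ext u
    have := Submodule.mem_span_range_iff_exists_fun NNReal (v := ((↑) : S → E n)) (x := u)
    rw [Subtype.range_coe] at this
    rw [Set.image_univ, Set.mem_range]
    exact this
  obtain ⟨K, hK, hKu⟩ := isSigmaCompact_univ.image hf
  rw [h, ← hKu]
  exact MeasurableSet.iUnion fun i => (hK i).measurableSet

theorem convexHull_subset_posSpan (S : Set (E n)) : convexHull ℝ S ⊆ posSpan S :=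
  convexHull_min (fun _ => mem_posSpan) fun _ hx _ hy _ _ ha hb _ =>
    add_mem_posSpan (smul_mem_posSpan ha hx) (smul_mem_posSpan hb hy)

theorem exists_inner_pos {S : Set (E n)} (hS : S.Finite) (h0 : (0 : E n) ∉ convexHull ℝ S) :
    ∃ ξ : E n, ∀ v ∈ S, (0 : ℝ) < inner ℝ ξ v := by
  obtain ⟨f, c, hc, hf⟩ := geometric_hahn_banach_point_closed (convex_convexHull ℝ S)
    (hS.isClosed_convexHull ℝ) h0
  refine ⟨(InnerProductSpace.toDual ℝ (E n)).symm f, fun v hv => ?_⟩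
  rw [InnerProductSpace.toDual_symm_apply]
  rw [map_zero] at hc
  exact hc.trans (hf v (subset_convexHull ℝ S hv))

/-- Write `0 = -aα + bk` with `k` in the convex hull of `S`. Since `k` pairs positively with `x`, it
is not zero; hence `a > 0` and `α = (b/a) k`. -/
theorem mem_posSpan_of_zero_mem_convexHull {S : Set (E n)} {α x : E n} (hα : α ≠ 0)
    (hx : ∀ v ∈ S, (0 : ℝ) < inner ℝ x v) (h : (0 : E n) ∈ convexHull ℝ (insert (-α) S)) :
    α ∈ posSpan S := by
  rcases S.eq_empty_or_nonempty with rfl | hne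
  · exact absurd (by simpa using h) hα
  rw [convexHull_insert hne, mem_convexJoin] at h
  obtain ⟨_, rfl, k, hk, a, b, ha, hb, hab, hsum⟩ := h
  have hkx : (0 : ℝ) < inner ℝ x k := by
    have : convexHull ℝ S ⊆ {k | (0 : ℝ) < inner ℝ x k} :=
      convexHull_min hx (convex_halfSpace_gt ⟨fun _ _ => inner_add_right _ _ _,
        fun _ _ => inner_smul_right _ _ _⟩ 0)
    exact this hk
  rcases ha.eq_or_lt with rfl | ha
  · rw [zero_add] at hab
    subst hab
    have : k = 0 := by simpa using hsum
    simp [this] at hkx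
  · have : α = (b / a) • k := by
      rw [smul_neg, neg_add_eq_zero] at hsum
      rw [div_eq_inv_mul, mul_smul, ← hsum, smul_smul, inv_mul_cancel₀ ha.ne', one_smul]
    rw [this]
    exact smul_mem_posSpan (by positivity) (convexHull_subset_posSpan S hk)

/-! ### Root cones -/

theorem posSpan_eq_coneOf {S : Set (E n)} {w : SignedPerm n}
    (hw : w ∈ linearExtensions (posRootsB n) S) (h : ∀ i, act w (simpleRoot i) ∈ posSpan S) :
    posSpan S = coneOf fun i => act w (simpleRoot i) := by
  refine Set.Subset.antisymm (fun u hu => ?_) ?_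
  · rw [coneOf_act, coneOf_simpleRoot]
    intro i
    rw [← inner_act w, act_act_inv, real_inner_comm]
    refine inner_posSpan_nonneg (fun v hv => ?_) hu
    obtain ⟨β, hβ, rfl⟩ := hw hv
    rw [inner_act, real_inner_comm]
    exact inner_weight_nonneg hβ i
  · rintro u ⟨c, hc, rfl⟩
    exact Submodule.sum_mem (Submodule.span NNReal S) fun i _ => smul_mem_posSpan (hc i) (h i)

/-- For another linear extension `w'`, the vector `w' ρ` is positive on the cone of `S`, hence on
the simple roots moved by `w`; so it lies in the chamber of `w` as well as in that of `w'`. -/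
theorem linearExtensions_eq_singleton {S : Set (E n)} (hS : S ⊆ rootsB n) {w : SignedPerm n}
    (hw : w ∈ linearExtensions (posRootsB n) S) (h : ∀ i, act w (simpleRoot i) ∈ posSpan S) :
    linearExtensions (posRootsB n) S = {w} := by
  refine Set.Subset.antisymm (fun w' hw' => ?_) (Set.singleton_subset_iff.2 hw)
  have hfin := finite_rootsB.subset hS
  have hρ := mem_interior_dualCone_posSpan hfin
    ((mem_linearExtensions_iff hS isDominant_rho).1 hw')
  refine eq_of_isDominant (x := act w' (rho n)) ?_ fun i => ?_
  · rw [act_inv_act]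
    exact isDominant_rho
  · rw [inner_act_left w⁻¹, inv_inv]
    exact inner_pos_of_mem_interior hρ (h i) (act_ne_zero w (simpleRoot_ne_zero i))

/-- `K + ℝ₊ α` and `K - ℝ₊ α` meet in `K`, and a rational function for the exponential integral
over each of them yields one for `K`. -/
theorem repOn_posSpan_of_split {S : Set (E n)} (hS : S.Finite) {α : E n} (hα : α ≠ 0)
    {r₁ r₂ : RatFun n}
    (h₁ : RepOn (interior (dualCone (posSpan (insert α S)))) r₁ (expInt (posSpan (insert α S))))
    (h₂ : RepOn (interior (dualCone (posSpan (insert (-α) S)))) r₂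
      (expInt (posSpan (insert (-α) S))))
    (hne₁ : (interior (dualCone (posSpan (insert α S)))).Nonempty)
    (hne₂ : (interior (dualCone (posSpan (insert (-α) S)))).Nonempty) :
    RepOn (interior (dualCone (posSpan S))) (r₁ + r₂) (expInt (posSpan S)) := by
  have hm := measurableSet_posSpan hS
  have hm₁ := measurableSet_posSpan (hS.insert α)
  have hm₂ := measurableSet_posSpan (hS.insert (-α))
  set K := posSpan S with hK
  set K₁ := posSpan (insert α S) with hK₁
  set K₂ := posSpan (insert (-α) S) with hK₂
  have hKK₁ : K ⊆ K₁ := posSpan_mono (Set.subset_insert _ _)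
  have hKK₂ : K ⊆ K₂ := posSpan_mono (Set.subset_insert _ _)
  have hαK₁ : α ∈ K₁ := mem_posSpan (Set.mem_insert _ _)
  have hαK₂ : -α ∈ K₂ := mem_posSpan (Set.mem_insert _ _)
  have hinter : ∀ u, u ∈ K₁ → u ∈ K₂ → u ∈ K := by
    intro u hu₁ hu₂
    obtain ⟨a, ha, k, hk, h⟩ := mem_posSpan_insert.1 hu₁
    obtain ⟨b, hb, l, hl, h'⟩ := mem_posSpan_insert.1 hu₂
    rcases ha.eq_or_lt with rfl | ha'
    · rw [zero_smul, zero_add] at h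
      rwa [h]
    -- Here `u = aα + k = -bα + l`; the weights `b` and `a` eliminate `α`.
    · have h3 : (a + b) • u = b • k + a • l := by
        rw [add_smul]
        nth_rw 1 [h']
        rw [h]
        module
      have h4 : u = (a + b)⁻¹ • (b • k + a • l) := by
        rw [← h3, smul_smul, inv_mul_cancel₀ (by positivity), one_smul]
      rw [h4]
      exact smul_mem_posSpan (by positivity)
        (add_mem_posSpan (smul_mem_posSpan hb hk) (smul_mem_posSpan ha hl))
  have hline : ∀ (u : E n) (t : ℝ), (u ∈ K₁ ∨ u ∈ K₂) → (u + t • α ∈ K₁ ∨ u + t • α ∈ K₂) := by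
    intro u t hu
    obtain ⟨a, k, hk, rfl⟩ : ∃ a : ℝ, ∃ k ∈ K, u = a • α + k := by
      rcases hu with hu | hu
      · obtain ⟨a, -, k, hk, h⟩ := mem_posSpan_insert.1 hu
        exact ⟨a, k, hk, h⟩
      · obtain ⟨a, -, k, hk, h⟩ := mem_posSpan_insert.1 hu
        exact ⟨-a, k, hk, by rw [h]; module⟩
    rcases le_total 0 (a + t) with h | h
    · exact Or.inl (mem_posSpan_insert.2 ⟨a + t, h, k, hk, by module⟩)
    · exact Or.inr (mem_posSpan_insert.2 ⟨-(a + t), by linarith, k, hk, by module⟩)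
  have hunion : ∀ u, (u ∈ K₂ ∨ u ∈ K₁ \ K) ↔ (u ∈ K₁ ∨ u ∈ K₂) := by
    intro u
    have := @hKK₂ u
    simp only [Set.mem_sdiff]
    tauto
  -- `K₂` and `K₁ \ K` partition `K + ℝα`, which is invariant under translation by `α`.
  have hB : RepOn {y | y ∈ interior (expDom (K₁ \ K)) ∧ (inner ℝ y α : ℝ) ≠ 0} (-r₂)
      (expInt (K₁ \ K)) := by
    refine h₂.continuation hm₂ (hm₁.diff hm) (fun u hu => ?_) (fun u hu => ?_)
      (fun u hu hu' => hu'.2 (hinter u hu'.1 hu)) (fun u => ?_) isOpen_interior hne₂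
      (interior_dualCone_subset_expDom hm₂)
    · simpa using add_mem_posSpan hu hαK₂
    · refine ⟨add_mem_posSpan hu.1 hαK₁, fun h => hu.2 (hinter u hu.1 ?_)⟩
      simpa using add_mem_posSpan (hKK₂ h) hαK₂
    · rw [hunion, hunion]
      refine ⟨fun h => ?_, fun h => by simpa using hline u 1 h⟩
      simpa using hline _ (-1) h
  have hU₁ : interior (dualCone K₁) ⊆ interior (dualCone K) :=
    interior_mono fun x hx u hu => hx u (hKK₁ hu)
  have hB₁ := (hB.mono (V := interior (dualCone K₁)) fun y hy =>
    ⟨interior_mono (expDom_anti Set.sdiff_subset)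
      (interior_dualCone_subset_interior_expDom hm₁ hy),
      (inner_pos_of_mem_interior hy hαK₁ hα).ne'⟩).neg
  rw [neg_neg] at hB₁
  -- On the smaller dual cone of `K₁` the integrals over `K₁`, `K` and `K₁ \ K` all converge, so
  -- they can be subtracted; the identity then extends to the dual cone of `K`.
  have hsum : RepOn (interior (dualCone K₁)) (r₁ + r₂) (expInt K) := by
    refine (h₁.add hB₁).congr fun x hx => ?_
    have : expInt (K₁ \ K) x = expInt K₁ x - expInt K x :=
      setIntegral_sdiff hm (interior_dualCone_subset_expDom hm₁ hx) hKK₁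
    rw [this]
    ring
  refine hsum.extend ((lineAnalytic_expInt K).mono
    (interior_dualCone_subset_interior_expDom hm)) (convex_dualCone K).interior isOpen_interior ?_
  rwa [Set.inter_eq_left.2 hU₁]

/-- The induction needs arbitrary sets of roots, since `S ∪ {±α}` need not be closed under positive
combinations. Both sets have fewer linear extensions than `S` because each has at least one. -/
theorem repOn_PsiB : ∀ (m : ℕ) {S : Set (E n)}, S ⊆ rootsB n →
    (linearExtensions (posRootsB n) S).ncard = m → (linearExtensions (posRootsB n) S).Nonempty →
    RepOn (interior (dualCone (posSpan S))) (PsiB S) (expInt (posSpan S)) := by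
  intro m
  induction m using Nat.strong_induction_on with
  | _ m ih =>
  intro S hS hm ⟨w, hw⟩
  by_cases h : ∀ i, act w (simpleRoot i) ∈ posSpan S
  · rw [PsiB, linearExtensions_eq_singleton hS hw h, sumOver_singleton, psiDenB_eq]
    have hrep := repOn_ratAct (b := simpleRoot) det_simpleRoot simpleRoot_ne_zero w
      (U := interior (dualCone (posSpan S))) fun x hx i =>
        inner_pos_of_mem_interior hx (h i) (act_ne_zero w (simpleRoot_ne_zero i))
    rwa [← posSpan_eq_coneOf hw h] at hrep
  · push Not at h
    obtain ⟨i, hi⟩ := h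
    set α := act w (simpleRoot i) with hα
    have hαr : α ∈ rootsB n := act_mem_rootsB w (posRootsB_subset (simpleRoot_mem i))
    have hα0 : α ≠ 0 := ne_zero_of_mem_rootsB hαr
    have hS₁ : insert α S ⊆ rootsB n := Set.insert_subset hαr hS
    have hS₂ : insert (-α) S ⊆ rootsB n := Set.insert_subset (neg_mem_rootsB hαr) hS
    obtain ⟨hunion, hdisj⟩ := linearExtensions_split hS hαr
    have hne₁ : (linearExtensions (posRootsB n) (insert α S)).Nonempty :=
      ⟨w, Set.insert_subset ⟨_, simpleRoot_mem i, rfl⟩ hw⟩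
    -- If no vector were positive on `S ∪ {-α}`, then 0 would lie in its convex hull and `α` in the
    -- cone of `S`, against the choice of `α`.
    have hne₂ : (linearExtensions (posRootsB n) (insert (-α) S)).Nonempty := by
      obtain ⟨ξ, hξ⟩ := exists_inner_pos (finite_rootsB.subset hS₂) fun h0 =>
        hi (mem_posSpan_of_zero_mem_convexHull hα0
          ((mem_linearExtensions_iff hS isDominant_rho).1 hw) h0)
      exact linearExtensions_nonempty hS₂ hξ
    have hcard := Set.ncard_union_eq hdisj (Set.toFinite _) (Set.toFinite _)
    rw [← hunion, hm] at hcard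
    have hc₁ := (Set.ncard_pos (Set.toFinite _)).2 hne₁
    have hc₂ := (Set.ncard_pos (Set.toFinite _)).2 hne₂
    have hU : ∀ {T : Set (E n)}, T ⊆ rootsB n → (linearExtensions (posRootsB n) T).Nonempty →
        (interior (dualCone (posSpan T))).Nonempty := fun hT ⟨v, hv⟩ =>
      ⟨_, mem_interior_dualCone_posSpan (finite_rootsB.subset hT)
        ((mem_linearExtensions_iff hT isDominant_rho).1 hv)⟩
    rw [PsiB, sumOver_union _ hunion hdisj]
    exact repOn_posSpan_of_split (finite_rootsB.subset hS) hα0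
      (ih _ (by omega) hS₁ rfl hne₁) (ih _ (by omega) hS₂ rfl hne₂) (hU hS₁ hne₁) (hU hS₂ hne₂)

/-! ### Weight cones -/

theorem coneOf_weight :
    coneOf (weight : Fin n → E n) = {u | ∀ i, 0 ≤ (inner ℝ u (simpleRoot i) : ℝ)} := by
  ext u
  constructor
  · rintro ⟨c, hc, rfl⟩ i
    rw [sum_inner]
    refine Finset.sum_nonneg fun j _ => ?_
    rw [inner_smul_left, real_inner_comm]
    exact mul_nonneg (hc j) (inner_weight_nonneg (simpleRoot_mem i) j)
  · exact fun h => ⟨_, h, (sum_inner_simpleRoot_smul_weight u).symm⟩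

theorem mem_coneOf_act_weight {w : SignedPerm n} {u : E n} :
    u ∈ coneOf (fun i => act w (weight i)) ↔
      ∀ i, 0 ≤ (inner ℝ (act w⁻¹ u) (simpleRoot i) : ℝ) := by
  rw [coneOf_act, coneOf_weight]
  rfl

theorem measurableSet_coneOf_act_weight (w : SignedPerm n) :
    MeasurableSet (coneOf fun i => act w (weight i)) := by
  have : coneOf (fun i => act w (weight i)) =
      ⋂ i, {u : E n | 0 ≤ (inner ℝ u (act w (simpleRoot i)) : ℝ)} := by
    ext u
    rw [mem_coneOf_act_weight, Set.mem_iInter]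
    refine forall_congr' fun i => ?_
    rw [← inner_act w, act_act_inv]
    rfl
  rw [this]
  exact (isClosed_iInter fun i => isClosed_le continuous_const (by fun_prop)).measurableSet

theorem measurableSet_weightCone (S : Set (E n)) : MeasurableSet (weightCone S) := by
  have : weightCone S = ⋂ v ∈ S, {u : E n | 0 ≤ (inner ℝ u v : ℝ)} := by
    ext u
    simp [weightCone]
  rw [this]
  exact (isClosed_biInter fun v _ => isClosed_le continuous_const (by fun_prop)).measurableSet

theorem coneOf_act_weight_subset {S : Set (E n)} {w : SignedPerm n}
    (hw : w ∈ linearExtensions (posRootsB n) S) :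
    coneOf (fun i => act w (weight i)) ⊆ weightCone S := by
  intro u hu v hv
  obtain ⟨β, hβ, rfl⟩ := hw hv
  rw [real_inner_comm, inner_act_left, real_inner_comm]
  exact inner_nonneg_of_weakly_dominant (mem_coneOf_act_weight.1 hu) hβ

theorem volume_inner_eq_zero {v : E n} (hv : v ≠ 0) :
    volume {u : E n | (inner ℝ u v : ℝ) = 0} = 0 := by
  have h : {u : E n | (inner ℝ u v : ℝ) = 0} = ((Submodule.span ℝ {v})ᗮ : Set (E n)) := by
    ext u
    rw [SetLike.mem_coe, Submodule.mem_orthogonal_singleton_iff_inner_left]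
    rfl
  rw [h]
  refine Measure.addHaar_submodule _ _ fun htop => hv ?_
  rw [Submodule.orthogonal_eq_top_iff, Submodule.span_singleton_eq_bot] at htop
  exact htop

theorem ae_regular : ∀ᵐ u : E n, ∀ v ∈ rootsB n, (inner ℝ u v : ℝ) ≠ 0 := by
  refine (ae_ball_iff finite_rootsB.countable).2 fun v hv => ?_
  rw [ae_iff]
  simpa using volume_inner_eq_zero (ne_zero_of_mem_rootsB hv)

open Classical in
theorem expInt_weightCone {S : Set (E n)} (hS : S ⊆ rootsB n) {x : E n}
    (hx : x ∈ expDom (weightCone S)) :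
    expInt (weightCone S) x =
      ∑ w ∈ Finset.univ.filter (fun w => w ∈ linearExtensions (posRootsB n) S),
        expInt (coneOf fun i => act w (weight i)) x := by
  unfold expInt
  rw [← integral_indicator (measurableSet_weightCone S)]
  simp only [← integral_indicator (measurableSet_coneOf_act_weight _)]
  rw [← integral_finsetSum _ fun w hw => ?_]
  swap
  · rw [Finset.mem_filter] at hw
    rw [integrable_indicator_iff (measurableSet_coneOf_act_weight w)]
    exact expDom_anti (coneOf_act_weight_subset hw.2) hx
  refine integral_congr_ae ?_
  filter_upwards [ae_regular] with u hu
  obtain ⟨w₀, η, hη, rfl⟩ := exists_act_eq u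
  have hdom : IsDominant η := fun i => lt_of_le_of_ne (hη i) fun h =>
    hu _ (act_mem_rootsB w₀ (posRootsB_subset (simpleRoot_mem i))) (by rw [inner_act, ← h])
  -- A point off all root hyperplanes lies in one closed chamber only, so at most one indicator in
  -- the sum is non-zero.
  have hC : ∀ w, act w₀ η ∈ coneOf (fun i => act w (weight i)) ↔ w = w₀ := by
    intro w
    rw [mem_coneOf_act_weight]
    refine ⟨fun h => eq_of_isDominant (x := act w₀ η) (fun i => ?_) (by rwa [act_inv_act]), ?_⟩
    · refine lt_of_le_of_ne (h i) fun h' =>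
        hu _ (act_mem_rootsB w (posRootsB_subset (simpleRoot_mem i))) ?_
      rw [h', ← inner_act w (act w⁻¹ _), act_act_inv]
    · rintro rfl i
      rw [act_inv_act]
      exact hη i
  have hK : act w₀ η ∈ weightCone S ↔ w₀ ∈ linearExtensions (posRootsB n) S := by
    rw [mem_linearExtensions_iff hS hdom]
    exact forall₂_congr fun v hv => ⟨fun h => lt_of_le_of_ne h (hu v (hS hv)).symm, le_of_lt⟩
  simp only [Set.indicator_apply, hC, hK]
  rw [Finset.sum_ite_eq']
  simp

theorem repOn_PhiB {S : Set (E n)} (hS : S ⊆ rootsB n) :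
    RepOn (interior (dualCone (weightCone S))) (PhiB S) (expInt (weightCone S)) := by
  classical
  refine RepOn.congr (RepOn.sum _ fun w hw => ?_) fun x hx =>
    (expInt_weightCone hS (interior_dualCone_subset_expDom (measurableSet_weightCone S) hx)).symm
  rw [Finset.mem_filter] at hw
  rw [phiDenB_eq]
  refine repOn_ratAct det_weight weight_ne_zero w fun x hx i => ?_
  refine inner_pos_of_mem_interior hx (coneOf_act_weight_subset hw.2
    ⟨Pi.single i 1, fun j => ?_, ?_⟩) (act_ne_zero w (weight_ne_zero i))
  · rw [Pi.single_apply]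
    split_ifs <;> norm_num
  · simp [Pi.single_apply]

/-- The dual cone contains the convex hull of 0 and `S`, which has interior points once `S` spans.
-/
theorem interior_dualCone_weightCone_nonempty {S : Set (E n)}
    (hS : Submodule.span ℝ S = ⊤) : (interior (dualCone (weightCone S))).Nonempty := by
  have h1 : convexHull ℝ (insert 0 S) ⊆ dualCone (weightCone S) := by
    refine convexHull_min (Set.insert_subset (fun u _ => by simp) fun v hv u hu => ?_)
      (convex_dualCone _)
    rw [real_inner_comm]
    exact hu v hv
  refine Set.Nonempty.mono (interior_mono h1) ?_
  rw [interior_convexHull_nonempty_iff_affineSpan_eq_top]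
  refine SetLike.coe_injective ?_
  rw [affineSpan_insert_zero, hS]
  rfl

theorem PhiB_split {S : Set (E n)} (hS : S ⊆ rootsB n) {α : E n} (hα : α ∈ rootsB n) :
    PhiB S = PhiB (insert α S) + PhiB (insert (-α) S) :=
  sumOver_union _ (linearExtensions_split hS hα).1 (linearExtensions_split hS hα).2

theorem span_insert_neg (S : Set (E n)) (α : E n) :
    Submodule.span ℝ (insert (-α) S) = Submodule.span ℝ (insert α S) := by
  have h : Submodule.span ℝ {-α} = Submodule.span ℝ {α} := by
    simpa using Submodule.span_singleton_smul_eq (isUnit_one.neg : IsUnit (-1 : ℝ)) α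
  rw [Submodule.span_insert, Submodule.span_insert, h]

/-- The two weight cones are the halves into which `α^⊥` cuts the weight cone of `S`, and the latter
is invariant under translation by `v`, so their valuations cancel. -/
theorem PhiB_insert_add_PhiB_insert_neg {S : Set (E n)} (hS : S ⊆ rootsB n) {α v : E n} (hα : α ∈ rootsB n)
    (hv : ∀ u ∈ S, (inner ℝ v u : ℝ) = 0) (hvα : (0 : ℝ) < inner ℝ v α)
    (htop : Submodule.span ℝ (insert α S) = ⊤) :
    PhiB (insert α S) + PhiB (insert (-α) S) = 0 := by
  have hS₁ : insert α S ⊆ rootsB n := Set.insert_subset hα hS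
  have hS₂ : insert (-α) S ⊆ rootsB n := Set.insert_subset (neg_mem_rootsB hα) hS
  set K₁ := weightCone (insert α S) with hK₁
  set K₂ := weightCone (insert (-α) S) with hK₂
  have hm₁ : MeasurableSet K₁ := measurableSet_weightCone _
  have hm₂ : MeasurableSet K₂ := measurableSet_weightCone _
  have hmem₁ : ∀ u, u ∈ K₁ ↔ 0 ≤ (inner ℝ u α : ℝ) ∧ u ∈ weightCone S := fun u => by
    simp [hK₁, weightCone]
  have hmem₂ : ∀ u, u ∈ K₂ ↔ (inner ℝ u α : ℝ) ≤ 0 ∧ u ∈ weightCone S := fun u => by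
    simp [hK₂, weightCone]
  have hshift : ∀ u, u + v ∈ weightCone S ↔ u ∈ weightCone S := fun u =>
    forall₂_congr fun β hβ => by rw [inner_add_left, hv β hβ, add_zero]
  -- `K₁` without its wall in `α^⊥`: this is disjoint from `K₂`, as `RepOn.continuation` demands,
  -- and has the same integral as `K₁`.
  set B : Set (E n) := {u | 0 < (inner ℝ u α : ℝ) ∧ u ∈ weightCone S} with hB
  have hmB : MeasurableSet B := by
    have h : IsOpen {u : E n | 0 < (inner ℝ u α : ℝ)} := isOpen_lt continuous_const (by fun_prop)
    exact h.measurableSet.inter (measurableSet_weightCone S)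
  have hBK : B ⊆ K₁ := fun u hu => (hmem₁ u).2 ⟨hu.1.le, hu.2⟩
  have hv0 : v ≠ 0 := by
    rintro rfl
    simp at hvα
  have hvK : v ∈ K₁ := (hmem₁ v).2 ⟨hvα.le, fun β hβ => (hv β hβ).ge⟩
  have hint : ∀ x, expInt B x = expInt K₁ x := by
    intro x
    refine setIntegral_congr_set (ae_eq_set.2 ⟨by simp [Set.sdiff_eq_empty.2 hBK], ?_⟩)
    refine measure_mono_null (fun u hu => ?_)
      (volume_inner_eq_zero (ne_zero_of_mem_rootsB hα))
    have h1 := (hmem₁ u).1 hu.1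
    exact le_antisymm (not_lt.1 fun h => hu.2 ⟨h, h1.2⟩) h1.1
  have hcont := (repOn_PhiB hS₂).continuation (B := B) (v := v) hm₂ hmB (fun u hu => ?_)
    (fun u hu => ⟨?_, (hshift u).2 hu.2⟩) (fun u hu hu' => ?_) (fun u => ?_) isOpen_interior
    (interior_dualCone_weightCone_nonempty (by rw [span_insert_neg, htop]))
    (interior_dualCone_subset_expDom hm₂)
  · have h2 := hcont.mono (V := interior (dualCone K₁)) fun y hy =>
      ⟨interior_mono (expDom_anti hBK) (interior_dualCone_subset_interior_expDom hm₁ hy),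
        (inner_pos_of_mem_interior hy hvK hv0).ne'⟩
    have h3 := (repOn_PhiB hS₁).add h2.neg
    rw [neg_neg] at h3
    refine (h3.congr fun x _ => ?_).eq_zero isOpen_interior
      (interior_dualCone_weightCone_nonempty htop)
    rw [hint]
    exact add_neg_cancel _
  · rw [← hK₂, hmem₂, hshift, inner_add_left] at hu
    exact (hmem₂ u).2 ⟨by linarith, hu.2⟩
  · rw [inner_add_left]
    exact add_pos hu.1 hvα
  · exact absurd hu'.1 (not_lt.2 ((hmem₂ u).1 hu).1)
  · have h : ∀ u, (u ∈ K₂ ∨ u ∈ B) ↔ u ∈ weightCone S := by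
      intro u
      rw [hmem₂, hB, Set.mem_ofPred_eq]
      rcases le_or_gt (inner ℝ u α : ℝ) 0 with h | h <;> simp [h, not_lt.2, not_le.2]
    rw [h, h, hshift]

/-- `Φ_S` vanishes if `S` does not span, that is, if the weight cone contains a line. -/
theorem PhiB_eq_zero : ∀ (m : ℕ) {S : Set (E n)}, S ⊆ rootsB n →
    n - Module.finrank ℝ (Submodule.span ℝ S) = m → Submodule.span ℝ S ≠ ⊤ → PhiB S = 0 := by
  intro m
  induction m using Nat.strong_induction_on with
  | _ m ih =>
  intro S hS hm hne
  obtain ⟨α, hα, hαS⟩ : ∃ α ∈ rootsB n, α ∉ Submodule.span ℝ S := by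
    by_contra! h
    exact hne (eq_top_iff.2 (span_rootsB.symm.le.trans (Submodule.span_le.2 h)))
  have hS₁ : insert α S ⊆ rootsB n := Set.insert_subset hα hS
  have hS₂ : insert (-α) S ⊆ rootsB n := Set.insert_subset (neg_mem_rootsB hα) hS
  rw [PhiB_split hS hα]
  by_cases htop : Submodule.span ℝ (insert α S) = ⊤
  · obtain ⟨v, hv, hv0⟩ := Submodule.exists_mem_ne_zero_of_ne_bot
      (mt Submodule.orthogonal_eq_bot_iff.1 hne)
    have hvS : ∀ u ∈ S, (inner ℝ v u : ℝ) = 0 := fun u hu =>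
      Submodule.inner_left_of_mem_orthogonal (Submodule.subset_span hu) hv
    -- A vector orthogonal to `S` and to `α` would be orthogonal to the whole space.
    have hvα : (inner ℝ v α : ℝ) ≠ 0 := by
      intro h0
      refine hv0 ((inner_self_eq_zero (𝕜 := ℝ)).1 ?_)
      have : Submodule.span ℝ (insert α S) ≤ (Submodule.span ℝ {v})ᗮ :=
        Submodule.span_le.2 fun u hu =>
          Submodule.mem_orthogonal_singleton_iff_inner_right.2
            (hu.elim (fun h => h ▸ h0) (hvS u))
      exact Submodule.mem_orthogonal_singleton_iff_inner_right.1 (this (htop ▸ Submodule.mem_top))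
    rcases lt_or_gt_of_ne hvα with h | h
    · refine PhiB_insert_add_PhiB_insert_neg (v := -v) hS hα (fun u hu => ?_) ?_ htop
      · rw [inner_neg_left, hvS u hu, neg_zero]
      · rw [inner_neg_left]
        linarith
    · exact PhiB_insert_add_PhiB_insert_neg hS hα hvS h htop
  · have hlt : Submodule.span ℝ S < Submodule.span ℝ (insert α S) :=
      lt_of_le_of_ne (Submodule.span_mono (Set.subset_insert _ _)) fun h =>
        hαS (h ▸ Submodule.subset_span (Set.mem_insert _ _))
    have h1 := Submodule.finrank_lt_finrank_of_lt hlt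
    have h2 := Submodule.finrank_le (Submodule.span ℝ (insert α S))
    rw [finrank_euclideanSpace_fin] at h2
    rw [ih _ (by omega) hS₁ rfl htop,
      ih _ (by rw [span_insert_neg]; omega) hS₂ rfl (by rwa [span_insert_neg]), add_zero]

/-! ### Linear extensions of posets -/

/-- Otherwise 0 is a convex combination of elements of `Q`. Solving for an element `y` with non-zero
coefficient puts `-y` in the positive span, hence in `Q` by closedness, which is forbidden. -/
theorem IsPhiPoset.exists_inner_pos {Φ Q : Set (E n)} (hfin : Φ.Finite)
    (hneg : ∀ v ∈ Φ, -v ∈ Φ) (h : IsPhiPoset Φ Q) :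
    ∃ ξ : E n, ∀ v ∈ Q, (0 : ℝ) < inner ℝ ξ v := by
  classical
  have hQ : Q.Finite := hfin.subset h.subset
  refine SignedPoset.exists_inner_pos hQ fun h0 => ?_
  rw [← hQ.coe_toFinset, Finset.mem_convexHull'] at h0
  obtain ⟨c, hc, hc1, hsum⟩ := h0
  obtain ⟨y, hy, hcy⟩ : ∃ y ∈ hQ.toFinset, c y ≠ 0 := by
    by_contra! h
    rw [Finset.sum_eq_zero h] at hc1
    exact zero_ne_one hc1
  have hyQ : y ∈ Q := hQ.mem_toFinset.1 hy
  rw [← Finset.add_sum_erase _ _ hy] at hsum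
  have hy' : -y = (c y)⁻¹ • ∑ z ∈ hQ.toFinset.erase y, c z • z := by
    rw [← neg_eq_of_add_eq_zero_right hsum, smul_neg, smul_smul, inv_mul_cancel₀ hcy, one_smul]
  refine h.neg_notMem y hyQ ?_
  rw [h.closed]
  refine ⟨?_, hneg y (h.subset hyQ)⟩
  rw [hy']
  refine smul_mem_posSpan (inv_nonneg.2 (hc y hy)) ?_
  refine Submodule.sum_mem (Submodule.span NNReal Q) fun z hz => ?_
  have hz' := Finset.mem_of_mem_erase hz
  exact smul_mem_posSpan (hc z hz') (mem_posSpan (hQ.mem_toFinset.1 hz'))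

/-! ### Coroots -/

theorem coroot_coroot (v : E n) : coroot (coroot v) = v := by
  rcases eq_or_ne v 0 with rfl | hv
  · simp [coroot]
  have hvv : (inner ℝ v v : ℝ) ≠ 0 := fun h => hv (inner_self_eq_zero.1 h)
  unfold coroot
  rw [inner_smul_left, inner_smul_right, smul_smul]
  simp only [conj_trivial]
  have : 2 / (2 / inner ℝ v v * (2 / inner ℝ v v * inner ℝ v v)) * (2 / inner ℝ v v) = (1 : ℝ) := by
    field_simp
  rw [this, one_smul]

theorem coroot_neg (v : E n) : coroot (-v) = -coroot v := by
  simp [coroot]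

theorem coroot_eq_self {v : E n} (h : inner ℝ v v = (2 : ℝ)) : coroot v = v := by
  rw [coroot, h]
  norm_num

theorem act_coroot (w : SignedPerm n) (v : E n) : act w (coroot v) = coroot (act w v) := by
  rw [coroot, coroot, act_smul, inner_act]

theorem coroot_e (i : Fin n) : coroot (e i : E n) = (2 : ℝ) • e i := by
  rw [coroot, inner_e, e_apply]
  simp

theorem coroot_two_smul_e (i : Fin n) : coroot ((2 : ℝ) • e i : E n) = e i := by
  rw [← coroot_e, coroot_coroot]

theorem inner_e_add_e {i j : Fin n} (h : i ≠ j) :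
    inner ℝ (e i + e j : E n) (e i + e j) = (2 : ℝ) := by
  simp only [inner_add_left, inner_add_right, inner_e, e_apply, if_neg h, if_neg h.symm, if_true]
  norm_num

theorem inner_e_sub_e {i j : Fin n} (h : i ≠ j) :
    inner ℝ (e i - e j : E n) (e i - e j) = (2 : ℝ) := by
  simp only [inner_sub_left, inner_sub_right, inner_e, e_apply, if_neg h, if_neg h.symm, if_true]
  norm_num

theorem coroot_mem_rootsB {v : E n} (hv : v ∈ rootsC n) : coroot v ∈ rootsB n := by
  have hadd : ∀ {i j : Fin n}, i ≠ j → coroot (e i + e j) ∈ rootsB n := fun h => by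
    rw [coroot_eq_self (inner_e_add_e h)]
    exact posRootsB_subset (e_add_e_mem h)
  have hsub : ∀ {i j : Fin n}, i ≠ j → coroot (e i - e j) ∈ rootsB n := fun {i j} h => by
    rw [coroot_eq_self (inner_e_sub_e h)]
    exact Or.inl ⟨i, j, h, Or.inr (Or.inl rfl)⟩
  rcases hv with ⟨i, j, hij, rfl | rfl | rfl | rfl⟩ | ⟨i, rfl | rfl⟩
  · exact hadd hij
  · exact hsub hij
  · rw [neg_add_eq_sub]
    exact hsub hij.symm
  · rw [← neg_add', coroot_neg]
    exact neg_mem_rootsB (hadd hij)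
  · rw [coroot_two_smul_e]
    exact posRootsB_subset (e_mem i)
  · rw [coroot_neg, coroot_two_smul_e]
    exact neg_mem_rootsB (posRootsB_subset (e_mem i))

theorem finite_rootsC : (rootsC n).Finite :=
  (finite_rootsB.image coroot).subset fun v hv => ⟨_, coroot_mem_rootsB hv, coroot_coroot v⟩

theorem neg_mem_rootsC {v : E n} (hv : v ∈ rootsC n) : -v ∈ rootsC n := by
  rcases hv with ⟨i, j, hij, rfl | rfl | rfl | rfl⟩ | ⟨i, rfl | rfl⟩
  · exact Or.inl ⟨i, j, hij, Or.inr (Or.inr (Or.inr (by abel)))⟩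
  · exact Or.inl ⟨i, j, hij, Or.inr (Or.inr (Or.inl (by abel)))⟩
  · exact Or.inl ⟨i, j, hij, Or.inr (Or.inl (by abel))⟩
  · exact Or.inl ⟨i, j, hij, Or.inl (by abel)⟩
  · exact Or.inr ⟨i, Or.inr rfl⟩
  · exact Or.inr ⟨i, Or.inl (neg_neg _)⟩

theorem posRootsC_eq : posRootsC n = coroot '' posRootsB n := by
  ext v
  constructor
  · rintro ((⟨i, j, hij, rfl⟩ | ⟨i, j, hij, rfl⟩) | ⟨i, rfl⟩)
    · exact ⟨_, e_add_e_mem hij, coroot_eq_self (inner_e_add_e hij)⟩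
    · exact ⟨_, e_sub_e_mem hij, coroot_eq_self (inner_e_sub_e hij.ne)⟩
    · exact ⟨_, e_mem i, coroot_e i⟩
  · rintro ⟨_, (⟨i, j, hij, rfl⟩ | ⟨i, j, hij, rfl⟩) | ⟨i, rfl⟩, rfl⟩
    · rw [coroot_eq_self (inner_e_add_e hij)]
      exact Or.inl (Or.inl ⟨i, j, hij, rfl⟩)
    · rw [coroot_eq_self (inner_e_sub_e hij.ne)]
      exact Or.inl (Or.inr ⟨i, j, hij, rfl⟩)
    · exact Or.inr ⟨i, coroot_e i⟩

/-- Taking coroots is injective, commutes with signed permutations and maps the positive roots of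
type B onto those of type C. -/
theorem linearExtensions_dual (P : Set (E n)) :
    linearExtensions (posRootsC n) (dual P) = linearExtensions (posRootsB n) P := by
  have hinj : Function.Injective (coroot : E n → E n) :=
    Function.LeftInverse.injective coroot_coroot
  ext w
  have h : act w '' posRootsC n = coroot '' (act w '' posRootsB n) := by
    rw [posRootsC_eq, Set.image_image, Set.image_image]
    simp only [act_coroot]
  change dual P ⊆ act w '' posRootsC n ↔ P ⊆ act w '' posRootsB n
  rw [h, dual, Set.image_subset_image_iff hinj]

/-! ### Rescaling denominators -/

theorem sumOver_C_mul (L : Set (SignedPerm n)) (a : ℝ) (D : Pol n) :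
    sumOver L (MvPolynomial.C a * D) = toRat (MvPolynomial.C a⁻¹) * sumOver L D := by
  classical
  unfold sumOver
  rw [Finset.mul_sum]
  refine Finset.sum_congr rfl fun w _ => ?_
  have h1 : polHom w (MvPolynomial.C a) = MvPolynomial.C a := by
    rw [← MvPolynomial.algebraMap_eq, AlgHom.commutes]
  have h2 : toRat (MvPolynomial.C a⁻¹ : Pol n) = (toRat (MvPolynomial.C a))⁻¹ :=
    map_inv₀ ((toRat (n := n)).comp MvPolynomial.C) a
  rw [map_div₀, map_div₀, map_one, ratAct_toRat, ratAct_toRat, map_mul, h1, map_mul, h2]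
  simp only [one_div, mul_inv]

theorem prod_ite_last (hn : 1 ≤ n) (a : Pol n) :
    ∏ i : Fin n, (if i.1 + 1 < n then 1 else a) = a := by
  rw [Finset.prod_eq_single ⟨n - 1, by omega⟩]
  · rw [if_neg (by simp only; omega)]
  · intro i _ hi
    rw [if_pos]
    have : i.1 ≠ n - 1 := fun h => hi (Fin.ext h)
    omega
  · exact fun h => absurd (Finset.mem_univ _) h

theorem psiDenC_eq (hn : 1 ≤ n) : psiDenC n = MvPolynomial.C 2 * psiDenB n := by
  rw [← prod_ite_last hn (MvPolynomial.C 2), psiDenB, ← Finset.prod_mul_distrib]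
  refine Finset.prod_congr rfl fun i _ => ?_
  split_ifs
  · rw [one_mul]
  · rw [show (MvPolynomial.C 2 : Pol n) = 2 from map_ofNat _ 2]

theorem phiDenC_eq (hn : 1 ≤ n) : phiDenC n = MvPolynomial.C (1 / 2) * phiDenB n := by
  rw [← prod_ite_last hn (MvPolynomial.C (1 / 2)), phiDenB, ← Finset.prod_mul_distrib]
  refine Finset.prod_congr rfl fun i _ => ?_
  split_ifs
  · rw [one_mul]
  · rw [Finset.mul_sum]

theorem PsiC_dual (hn : 1 ≤ n) (P : Set (E n)) :
    PsiC (dual P) = toRat (MvPolynomial.C (1 / 2)) * PsiB P := by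
  rw [PsiC, linearExtensions_dual, psiDenC_eq hn, sumOver_C_mul, PsiB, one_div]

theorem PhiC_dual (hn : 1 ≤ n) (P : Set (E n)) :
    PhiC (dual P) = toRat (MvPolynomial.C 2) * PhiB P := by
  rw [PhiC, linearExtensions_dual, phiDenC_eq hn, sumOver_C_mul, PhiB, one_div, inv_inv]

/-! ### The valuation of a cone -/

theorem isPointed_of_nonempty {K : Set (E n)} (h : (interior (dualCone K)).Nonempty) :
    IsPointed K := by
  rintro ⟨u, v, hv, hline⟩
  obtain ⟨x, hx⟩ := h
  obtain ⟨c, hc, hx⟩ := exists_mul_norm_le hx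
  have hvn := norm_pos_iff.2 hv
  -- The pairings of `x` with `u + tv` and `u - tv` add up to `2⟨x, u⟩`, while the two norms add up
  -- to at least `2|t|‖v‖`, which is unbounded.
  have key : ∀ t : ℝ, c * (t * ‖v‖) ≤ inner ℝ x u := by
    intro t
    have h1 := hx _ (hline t)
    have h2 := hx _ (hline (-t))
    rw [inner_add_right, inner_smul_right] at h1 h2
    have h3 : ‖(u + t • v) - (u + (-t) • v)‖ = 2 * |t| * ‖v‖ := by
      have : (u + t • v) - (u + (-t) • v) = (2 * t) • v := by module
      rw [this, norm_smul, Real.norm_eq_abs, abs_mul, abs_two]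
    have h4 := norm_sub_le (u + t • v) (u + (-t) • v)
    have h5 : t * ‖v‖ ≤ |t| * ‖v‖ := by gcongr; exact le_abs_self t
    nlinarith
  have h1 := key ((inner ℝ x u + 1) / (c * ‖v‖))
  have h2 : c * ((inner ℝ x u + 1) / (c * ‖v‖) * ‖v‖) = inner ℝ x u + 1 := by field_simp
  linarith

theorem expInt_eq_zero_of_not_isFullDim {K : Set (E n)} (h : ¬IsFullDim K) (x : E n) :
    expInt K x = 0 :=
  setIntegral_measure_zero _
    (measure_mono_null Submodule.subset_span (Measure.addHaar_submodule _ _ h))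

theorem isExpIntegral_of_repOn {K : Set (E n)} (hK : MeasurableSet K) {r : RatFun n}
    (h : RepOn (interior (dualCone K)) r (expInt K)) {c : ENNReal} (hc : c ≠ ⊤) :
    IsExpIntegral (c • volume) K (toRat (MvPolynomial.C c.toReal) * r) := by
  intro x hx
  constructor
  · rw [IntegrableOn, Measure.restrict_smul]
    exact Integrable.smul_measure (interior_dualCone_subset_expDom hK hx) hc
  · rw [Measure.restrict_smul, integral_smul_measure]
    exact (h.hasValueAt ((lineAnalytic_expInt K).mono
      (interior_dualCone_subset_interior_expDom hK)) isOpen_interior hx).const_mul _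

/-- A rational function that represents the exponential integral of a cone `K` is the valuation
of `K`, provided that it vanishes if the dual cone has no interior. -/
theorem eq_s_and_isExpIntegral {K : Set (E n)} (hK : MeasurableSet K) {r : RatFun n}
    (h : RepOn (interior (dualCone K)) r (expInt K))
    (hne : (interior (dualCone K)).Nonempty ∨ (¬IsPointed K ∧ r = 0)) {c : ENNReal} (hc : c ≠ ⊤) :
    toRat (MvPolynomial.C c.toReal) * r = s (c • volume) K ∧
      IsExpIntegral (c • volume) K (toRat (MvPolynomial.C c.toReal) * r) := by
  have hexp := isExpIntegral_of_repOn hK h hc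
  refine ⟨?_, hexp⟩
  unfold s
  split_ifs with hs
  · obtain hne | hne := hne
    · exact eq_of_hasValueAt isOpen_interior hne (fun x hx => (hexp x hx).2)
        fun x hx => (hs.2.2.choose_spec x hx).2
    · exact absurd hs.1 hne.1
  · obtain hne | hne := hne
    -- The existence clause in `s` is witnessed by the function at hand and pointedness is
    -- automatic, so only full-dimensionality can fail. Then `K` is a null set and `r` vanishes on
    -- an open set.
    · have hdim : ¬IsFullDim K := fun hd => hs ⟨isPointed_of_nonempty hne, hd, _, hexp⟩
      rw [(h.congr fun x _ => expInt_eq_zero_of_not_isFullDim hdim x).eq_zero isOpen_interior hne,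
        mul_zero]
    · rw [hne.2, mul_zero]

theorem PsiB_eq_s {P : Set (E n)} (hP : P ⊆ rootsB n) {ξ : E n}
    (hξ : ∀ v ∈ P, (0 : ℝ) < inner ℝ ξ v) {c : ENNReal} (hc : c ≠ ⊤) :
    toRat (MvPolynomial.C c.toReal) * PsiB P = s (c • volume) (rootCone P) ∧
      IsExpIntegral (c • volume) (rootCone P) (toRat (MvPolynomial.C c.toReal) * PsiB P) :=
  eq_s_and_isExpIntegral (measurableSet_posSpan (finite_rootsB.subset hP))
    (repOn_PsiB _ hP rfl (linearExtensions_nonempty hP hξ))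
    (Or.inl ⟨ξ, mem_interior_dualCone_posSpan (finite_rootsB.subset hP) hξ⟩) hc

theorem PhiB_eq_s {P : Set (E n)} (hP : P ⊆ rootsB n) {c : ENNReal} (hc : c ≠ ⊤) :
    toRat (MvPolynomial.C c.toReal) * PhiB P = s (c • volume) (weightCone P) ∧
      IsExpIntegral (c • volume) (weightCone P) (toRat (MvPolynomial.C c.toReal) * PhiB P) := by
  refine eq_s_and_isExpIntegral (measurableSet_weightCone P) (repOn_PhiB hP) ?_ hc
  by_cases htop : Submodule.span ℝ P = ⊤
  · exact Or.inl (interior_dualCone_weightCone_nonempty htop)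
  · refine Or.inr ⟨fun hp => hp ?_, PhiB_eq_zero _ hP rfl htop⟩
    obtain ⟨v, hv, hv0⟩ := Submodule.exists_mem_ne_zero_of_ne_bot
      (mt Submodule.orthogonal_eq_bot_iff.1 htop)
    refine ⟨0, v, hv0, fun t u hu => ?_⟩
    rw [zero_add, inner_smul_left,
      Submodule.inner_left_of_mem_orthogonal (Submodule.subset_span hu) hv, mul_zero]

end SignedPoset

end

theorem theorem3p5p1 (n : ℕ) (hn : 1 ≤ n) (P : Set (SignedPoset.E n)) :
    (SignedPoset.IsPhiPoset (SignedPoset.rootsB n) P →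
      (SignedPoset.PsiB P = SignedPoset.s volume (SignedPoset.rootCone P) ∧
        SignedPoset.IsExpIntegral volume (SignedPoset.rootCone P) (SignedPoset.PsiB P)) ∧
      (SignedPoset.PhiB P = SignedPoset.s volume (SignedPoset.weightCone P) ∧
        SignedPoset.IsExpIntegral volume (SignedPoset.weightCone P) (SignedPoset.PhiB P))) ∧
    (SignedPoset.IsPhiPoset (SignedPoset.rootsC n) (SignedPoset.dual P) →
      (SignedPoset.PsiC (SignedPoset.dual P) =
          SignedPoset.s ((1 / 2 : ENNReal) • volume) (SignedPoset.rootCone P) ∧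
        SignedPoset.IsExpIntegral ((1 / 2 : ENNReal) • volume) (SignedPoset.rootCone P)
          (SignedPoset.PsiC (SignedPoset.dual P))) ∧
      (SignedPoset.PhiC (SignedPoset.dual P) =
          SignedPoset.s ((2 : ENNReal) • volume) (SignedPoset.weightCone P) ∧
        SignedPoset.IsExpIntegral ((2 : ENNReal) • volume) (SignedPoset.weightCone P)
          (SignedPoset.PhiC (SignedPoset.dual P)))) := by
  open SignedPoset in
  constructor
  · intro h
    obtain ⟨ξ, hξ⟩ := h.exists_inner_pos finite_rootsB fun _ => neg_mem_rootsB
    have hPsi := PsiB_eq_s h.subset hξ ENNReal.one_ne_top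
    have hPhi := PhiB_eq_s h.subset ENNReal.one_ne_top
    simp only [ENNReal.toReal_one, map_one, one_mul, one_smul] at hPsi hPhi
    exact ⟨hPsi, hPhi⟩
  · intro h
    obtain ⟨ξ, hξ⟩ := h.exists_inner_pos finite_rootsC fun _ => neg_mem_rootsC
    have hP : P ⊆ rootsB n := fun v hv => by
      rw [← coroot_coroot v]
      exact coroot_mem_rootsB (h.subset ⟨v, hv, rfl⟩)
    -- Coroots are non-negative multiples of roots, so positivity on the dual passes to `P`, and the
    -- type B results apply with rescaled measures.
    have hξP : ∀ v ∈ P, (0 : ℝ) < inner ℝ ξ v := by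
      intro v hv
      have h1 := hξ _ ⟨v, hv, rfl⟩
      rw [coroot, inner_smul_right] at h1
      exact pos_of_mul_pos_right h1 (div_nonneg zero_le_two real_inner_self_nonneg)
    have hPsi := PsiB_eq_s hP hξP (c := 1 / 2) (by simp)
    have hPhi := PhiB_eq_s hP ENNReal.ofNat_ne_top (c := 2)
    rw [PsiC_dual hn, PhiC_dual hn]
    simp only [ENNReal.toReal_div, ENNReal.toReal_one, ENNReal.toReal_ofNat] at hPsi hPhi
    exact ⟨hPsi, hPhi⟩
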